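/- Let $\mathcal M_0$ be a smooth Hausdorff manifold without boundary of finite dimension at least $1$, with a smooth Riemannian metric $g_0$, a smooth vector field $\delta$ and a smooth positive function $\beta$, and let $\varphi$ be a smooth positive function on $\mathcal M=\mathcal M_0\times\mathbb R$. Let $(\mathcal M,g)$ be the conformally standard stationary Lorentzian manifold with metric $$g(x,t)[(y,\tau),(y,\tau)]=\varphi(x,t)\big(g_0(x)[y,y]+2g_0(x)[\delta(x),y]\,\tau-\beta(x)\tau^2\big),\qquad (y,\tau)\in T_x\mathcal M_0\times\mathbb R,$$ time-oriented by $\partial_t$: a tangent vector $v$ is non-spacelike if $v\ne0$ and $g[v,v]\le 0$, lightlike if $v\neq 0$ and $g[v,v]=0$, and future-pointing if $g[v,\partial_t]<0$. A smooth curve on a compact interval is future-pointing non-spacelike if all its velocity vectors are. A continuous curve $\gamma\colon[a,b]\to\mathcal M$, $a<b$, is future-pointing non-spacelike if every $s_0\in[a,b]$ has an interval $J$ as a neighbourhood in $[a,b]$, and $\gamma(s_0)$ a convex normal neighbourhood $U$, such that for all $s_1<s_2$ in $J$ there is a smooth future-pointing non-spacelike curve from $\gamma(s_1)$ to $\gamma(s_2)$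 contained in $U$. Let $J^+(p)$ (resp. $J^-(p)$) be the set of the points $q$ such that there is a continuous future-pointing non-spacelike curve from $p$ to $q$ (resp. from $q$ to $p$). A future-pointing piecewise lightlike geodesic from $p$ to $q$ is a continuous curve $\gamma\colon[a,b]\to\mathcal M$ with $\gamma(a)=p$, $\gamma(b)=q$, for which there is a subdivision $a=\tau_0<\tau_1<\dots<\tau_m=b$, $m\ge1$, such that each $\gamma|_{[\tau_i,\tau_{i+1}]}$ is a smooth geodesic of $g$ (that is, $\nabla_\gamma\dot\gamma=0$ for the Levi-Civita connection of $g$) whose velocity is everywhere lightlike and future-pointing. Then any two causally connected points $p,q\in\mathcal M$ are joined by a piecewise lightlike geodesic: if $q\in J^+(p)$, there is a future-pointing piecewise lightlike geodesic from $p$ to $q$, and if $q\in J^-(p)$, there is one from $q$ to $p$. -/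

import Mathlib

open Set
open scoped Manifold ContDiff Topology

noncomputable section

namespace Spacetime

section General

variable {E : Type*} [NormedAddCommGroup E] [NormedSpace ℝ E]
  {H : Type*} [TopologicalSpace H] {I : ModelWithCorners ℝ E H}
  {M : Type*} [TopologicalSpace M] [ChartedSpace H M]

/-- A field of bilinear forms on the tangent spaces of `M`. -/
abbrev BilinField (I : ModelWithCorners ℝ E H) (M : Type*) [TopologicalSpace M]
    [ChartedSpace H M] : Type _ :=
  ∀ x : M, TangentSpace I x →L[ℝ] TangentSpace I x →L[ℝ] ℝ

/-- The matrix `(g_ij)` of `g` in the coordinate system `extChartAt I x₀`, as a function of the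
coordinates `u`, written without indices as a bilinear form on the model space. -/
def coordMetric (g : BilinField I M) (x₀ : M) (u : E) : E →L[ℝ] E →L[ℝ] ℝ :=
  let B : E →L[ℝ] E →L[ℝ] ℝ := g ((extChartAt I x₀).symm u)
  let A : E →L[ℝ] E := mfderiv 𝓘(ℝ, E) I (extChartAt I x₀).symm u
  B.bilinearComp A A

/-- Christoffel symbols of the first kind of a metric `G` on (an open subset of) `E`:
`½ (∂_v G(w, z) + ∂_w G(v, z) - ∂_z G(v, w))`, as a covector in `z`. -/
def christoffelFirst (G : E → E →L[ℝ] E →L[ℝ] ℝ) (u v w : E) : E →L[ℝ] ℝ :=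
  (1 / 2 : ℝ) • (fderiv ℝ G u v w + fderiv ℝ G u w v
    - ((fderiv ℝ G u).flip v).flip w)

/-- Christoffel symbols of the second kind (those of the Levi-Civita connection):
`Γ(u)(v, w) = Γ^k_ij v^i w^j ∂_k`, obtained by raising the index with `G u : E → E*`. -/
def christoffel (G : E → E →L[ℝ] E →L[ℝ] ℝ) (u v w : E) : E :=
  (G u).inverse (christoffelFirst G u v w)

/-- The velocity at `s` of a curve defined on the interval `J`
(one-sided at the end points of `J`). -/
def velocity (I : ModelWithCorners ℝ E H) (γ : ℝ → M) (J : Set ℝ) (s : ℝ) :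
    TangentSpace I (γ s) :=
  mfderivWithin 𝓘(ℝ, ℝ) I γ J s (1 : ℝ)

/-- The covariant derivative `∇_γ γ'` at the parameter `s` of the velocity of a curve `γ` on the
interval `J`, for the Levi-Civita connection of `g`: `c'' + Γ(c)(c', c')`, where `c` is `γ`
written in the chart at `γ s` (the chart that identifies `TangentSpace I (γ s)` with `E`). -/
def acceleration (g : BilinField I M) (γ : ℝ → M) (J : Set ℝ) (s : ℝ) :
    TangentSpace I (γ s) :=
  let c : ℝ → E := fun r => extChartAt I (γ s) (γ r)
  (derivWithin (derivWithin c J) J s +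
    christoffel (coordMetric g (γ s)) (c s) (derivWithin c J s) (derivWithin c J s) : E)

/-- `γ` restricted to `[a, b]` is a geodesic of `g`: smooth up to the end points, with
`∇_γ γ' = 0`. -/
structure IsGeodesic (g : BilinField I M) (γ : ℝ → M) (a b : ℝ) : Prop where
  smooth : ContMDiffOn 𝓘(ℝ, ℝ) I ∞ γ (Icc a b)
  acceleration_eq_zero : ∀ s ∈ Icc a b, acceleration g γ (Icc a b) s = 0

/-- `U` is a normal neighbourhood of `x`: the exponential map of `g` at `x` restricts to a
diffeomorphism `e` from an open star-shaped neighbourhood of `0` in the tangent space at `x` (which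
as a vector space is the model space `E`) onto `U`. That `e` is the exponential map is the
statement that `s ↦ e (s v)` is the geodesic with initial point `x` and initial velocity `v`. -/
def IsNormalNhd (g : BilinField I M) (U : Set M) (x : M) : Prop :=
  ∃ e : OpenPartialHomeomorph E M,
    e.target = U ∧ (0 : E) ∈ e.source ∧ StarConvex ℝ (0 : E) e.source ∧ e 0 = x ∧
    ContMDiffOn 𝓘(ℝ, E) I ∞ e e.source ∧ ContMDiffOn I 𝓘(ℝ, E) ∞ e.symm e.target ∧
    ∀ v ∈ e.source, IsGeodesic g (fun s : ℝ => e (s • v)) 0 1 ∧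
      velocity I (fun s : ℝ => e (s • v)) (Icc 0 1) 0 = v

/-- A convex normal open set: a normal neighbourhood of each of its points. -/
def IsConvexNormal (g : BilinField I M) (U : Set M) : Prop :=
  IsOpen U ∧ ∀ x ∈ U, IsNormalNhd g U x

/-- A tangent vector is lightlike if it is nonzero and `g(v, v) = 0`. -/
def IsLightlike (g : BilinField I M) (x : M) (v : TangentSpace I x) : Prop :=
  v ≠ 0 ∧ g x v v = 0

/-- A tangent vector is non-spacelike (causal) if it is nonzero and `g(v, v) ≤ 0`. -/
def IsNonSpacelike (g : BilinField I M) (x : M) (v : TangentSpace I x) : Prop :=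
  v ≠ 0 ∧ g x v v ≤ 0

/-- Future-pointing with respect to the time orientation given by the vector field `Y`. -/
def IsFuturePointing (g : BilinField I M) (Y : ∀ x : M, TangentSpace I x) (x : M)
    (v : TangentSpace I x) : Prop :=
  g x v (Y x) < 0

/-- A smooth future-pointing non-spacelike curve on `[a, b]`. -/
structure IsSmoothCausalCurve (g : BilinField I M) (Y : ∀ x : M, TangentSpace I x)
    (γ : ℝ → M) (a b : ℝ) : Prop where
  lt : a < b
  smooth : ContMDiffOn 𝓘(ℝ, ℝ) I ∞ γ (Icc a b)
  nonSpacelike : ∀ s ∈ Icc a b, IsNonSpacelike g (γ s) (velocity I γ (Icc a b) s)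
  future : ∀ s ∈ Icc a b, IsFuturePointing g Y (γ s) (velocity I γ (Icc a b) s)

/-- A continuous future-pointing non-spacelike curve on `[a, b]`: every `s₀` has a neighbourhood
`J` in `[a, b]`, an interval, and `γ s₀` has a convex normal neighbourhood `U`, such that
for `s₁ < s₂` in `J` the points `γ s₁` and `γ s₂` are joined by a smooth future-pointing
non-spacelike curve contained in `U`. -/
structure IsCausalCurve (g : BilinField I M) (Y : ∀ x : M, TangentSpace I x)
    (γ : ℝ → M) (a b : ℝ) : Prop where
  lt : a < b
  continuousOn : ContinuousOn γ (Icc a b)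
  locally_causal : ∀ s₀ ∈ Icc a b, ∃ U : Set M, IsConvexNormal g U ∧ γ s₀ ∈ U ∧
    ∃ J ∈ 𝓝[Icc a b] s₀, J ⊆ Icc a b ∧ J.OrdConnected ∧
      ∀ s₁ ∈ J, ∀ s₂ ∈ J, s₁ < s₂ → ∃ (σ : ℝ → M) (c d : ℝ),
        IsSmoothCausalCurve g Y σ c d ∧ σ c = γ s₁ ∧ σ d = γ s₂ ∧ MapsTo σ (Icc c d) U

/-- The causal future `J⁺(p)`. -/
def causalFuture (g : BilinField I M) (Y : ∀ x : M, TangentSpace I x) (p : M) : Set M :=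
  {q | ∃ (γ : ℝ → M) (a b : ℝ), IsCausalCurve g Y γ a b ∧ γ a = p ∧ γ b = q}

/-- The causal past `J⁻(p)`. -/
def causalPast (g : BilinField I M) (Y : ∀ x : M, TangentSpace I x) (p : M) : Set M :=
  {q | ∃ (γ : ℝ → M) (a b : ℝ), IsCausalCurve g Y γ a b ∧ γ a = q ∧ γ b = p}

/-- A future-pointing lightlike geodesic on `[a, b]`. -/
structure IsLightlikeGeodesic (g : BilinField I M) (Y : ∀ x : M, TangentSpace I x)
    (γ : ℝ → M) (a b : ℝ) : Prop where
  lt : a < b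
  geodesic : IsGeodesic g γ a b
  lightlike : ∀ s ∈ Icc a b, IsLightlike g (γ s) (velocity I γ (Icc a b) s)
  future : ∀ s ∈ Icc a b, IsFuturePointing g Y (γ s) (velocity I γ (Icc a b) s)

/-- A future-pointing piecewise lightlike geodesic on `[a, b]`: a continuous curve which, for some
subdivision `a = τ 0 < τ 1 < ⋯ < τ (n + 1) = b`, restricts to a future-pointing
lightlike geodesic on every `[τ i, τ (i + 1)]`. -/
def IsPiecewiseLightlikeGeodesic (g : BilinField I M) (Y : ∀ x : M, TangentSpace I x)
    (γ : ℝ → M) (a b : ℝ) : Prop :=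
  ContinuousOn γ (Icc a b) ∧
  ∃ (n : ℕ) (τ : Fin (n + 2) → ℝ), StrictMono τ ∧ τ 0 = a ∧ τ (Fin.last (n + 1)) = b ∧
    ∀ i : Fin (n + 1), IsLightlikeGeodesic g Y γ (τ i.castSucc) (τ i.succ)

end General

/-- The data of a conformally standard stationary Lorentzian manifold `M₀ × ℝ`: a smooth Riemannian
metric `g₀`, a smooth vector field `δ` and a smooth positive function `β` on `M₀`, and a smooth
positive function `φ` on `M₀ × ℝ`. -/
structure ConformallyStandardStationary (E : Type*) [NormedAddCommGroup E] [NormedSpace ℝ E]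
    (M₀ : Type*) [TopologicalSpace M₀] [ChartedSpace E M₀] [IsManifold 𝓘(ℝ, E) ∞ M₀] where
  g₀ : Bundle.ContMDiffRiemannianMetric 𝓘(ℝ, E) ∞ E
    (fun x : M₀ => TangentSpace 𝓘(ℝ, E) x)
  δ : ∀ x : M₀, TangentSpace 𝓘(ℝ, E) x
  δ_smooth : ContMDiff 𝓘(ℝ, E) 𝓘(ℝ, E).tangent ∞
    (fun x => (⟨x, δ x⟩ : TangentBundle 𝓘(ℝ, E) M₀))
  β : M₀ → ℝ
  β_smooth : ContMDiff 𝓘(ℝ, E) 𝓘(ℝ, ℝ) ∞ β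
  β_pos : ∀ x, 0 < β x
  φ : M₀ × ℝ → ℝ
  φ_smooth : ContMDiff (𝓘(ℝ, E).prod 𝓘(ℝ, ℝ)) 𝓘(ℝ, ℝ) ∞ φ
  φ_pos : ∀ p, 0 < φ p

namespace ConformallyStandardStationary

variable {E : Type*} [NormedAddCommGroup E] [NormedSpace ℝ E]
  {M₀ : Type*} [TopologicalSpace M₀] [ChartedSpace E M₀] [IsManifold 𝓘(ℝ, E) ∞ M₀]

/-- The Lorentzian metric of the spacetime `M₀ × ℝ`; see `metric_apply`, `metric_apply_self`. -/
def metric (S : ConformallyStandardStationary E M₀) :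
    BilinField (𝓘(ℝ, E).prod 𝓘(ℝ, ℝ)) (M₀ × ℝ) := fun p =>
  let G : E →L[ℝ] E →L[ℝ] ℝ := S.g₀.inner p.1
  let fst : E × ℝ →L[ℝ] E := ContinuousLinearMap.fst ℝ E ℝ
  let snd : E × ℝ →L[ℝ] ℝ := ContinuousLinearMap.snd ℝ E ℝ
  let θ : E × ℝ →L[ℝ] ℝ := (G (S.δ p.1)).comp fst
  (S.φ p • (G.bilinearComp fst fst + θ.smulRight snd + snd.smulRight θ
    - S.β p.1 • snd.smulRight snd) : E × ℝ →L[ℝ] E × ℝ →L[ℝ] ℝ)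

theorem metric_apply (S : ConformallyStandardStationary E M₀) (x : M₀) (t : ℝ)
    (y y' : E) (τ τ' : ℝ) :
    S.metric (x, t) (y, τ) (y', τ') = S.φ (x, t) *
      (S.g₀.inner x y y' + S.g₀.inner x (S.δ x) y * τ' + S.g₀.inner x (S.δ x) y' * τ
        - S.β x * τ * τ') := by
  change S.φ (x, t) * (S.g₀.inner x y y' + S.g₀.inner x (S.δ x) y * τ'
    + τ * S.g₀.inner x (S.δ x) y' - S.β x * (τ * τ')) = _
  ring

theorem metric_apply_self (S : ConformallyStandardStationary E M₀) (x : M₀) (t : ℝ)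
    (y : E) (τ : ℝ) :
    S.metric (x, t) (y, τ) (y, τ) = S.φ (x, t) *
      (S.g₀.inner x y y + 2 * S.g₀.inner x (S.δ x) y * τ - S.β x * τ ^ 2) := by
  rw [metric_apply]; ring

/-- The vector field `∂_t`, which time-orients the spacetime. -/
def timeField (_S : ConformallyStandardStationary E M₀) :
    ∀ p : M₀ × ℝ, TangentSpace (𝓘(ℝ, E).prod 𝓘(ℝ, ℝ)) p :=
  fun _ => ((0, 1) : E × ℝ)

end ConformallyStandardStationary

end Spacetime

end

/-! The heart is local. Let a smooth causal curve lead from `x` to `y` inside a convex normal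
neighbourhood, and follow a future lightlike geodesic issuing from `x`. Seen in the normal chart at
`y`, its starting point lies in the closed past cone. If the geodesic is followed until its time
coordinate exceeds that of `y`, its end point lies outside that cone. The last point in the cone is
on its boundary, hence is joined to `y` by a lightlike radial geodesic. So two lightlike geodesics
suffice: one from `x` to this point, one from it to `y` (`reflTransGen_of_time_lt`).

Two facts support this. The coordinate `t` increases strictly along future causal curves
(`time_lt`). A causal curve from the centre of a normal chart stays in the closed causal cone of the
tangent space (`mem_cone_of_causal`). The second rests on the Gauss lemma: inside the timelike cone
the quadratic form decreases along a timelike curve, so the curve cannot leave. Causal curves are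
limits of timelike ones, obtained by tilting in the direction of `∂_t`; here one uses that, up to
the factor `φ`, the metric does not depend on `t`.

The time condition holds only for `y` close to `x`, with a bound depending on `x`. The passage to a
whole causal curve is therefore a supremum argument comparing each parameter with its neighbours on
both sides (`relates_endpoints_of_locally`). The neighbours on the left are treated by reversing
time: everything is proved for the orientation `κ ∂_t`, and used with `κ = 1` and `κ = -1`. -/

noncomputable section

namespace Spacetime

/-! ### Linear algebra of Lorentzian forms. -/

section LorentzForm

variable {V : Type*} [NormedAddCommGroup V] [NormedSpace ℝ V]

/-- A symmetric bilinear form of Lorentzian signature, for which `Y` is timelike. -/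
structure IsLorentzForm (B : V →L[ℝ] V →L[ℝ] ℝ) (Y : V) : Prop where
  symm : ∀ v w, B v w = B w v
  neg : B Y Y < 0
  pos : ∀ v, B v Y = 0 → v ≠ 0 → 0 < B v v

namespace IsLorentzForm

variable {B : V →L[ℝ] V →L[ℝ] ℝ} {Y v w : V}

theorem apply_ne_zero (h : IsLorentzForm B Y) (hv : B v v ≤ 0) (hv0 : v ≠ 0) : B v Y ≠ 0 :=
  fun h0 => (h.pos v h0 hv0).not_ge hv

theorem ne_zero_of_neg (hv : B v v < 0) : v ≠ 0 := by
  rintro rfl; simp at hv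

theorem eq_zero_of_forall (h : IsLorentzForm B Y) (hv : ∀ w, B v w = 0) : v = 0 := by
  by_contra hv0
  exact (h.pos v (hv Y) hv0).ne' (hv v)

/-- A timelike and a causal vector in the same half cone have negative product. -/
theorem apply_neg (h : IsLorentzForm B Y) (hv : B v v < 0) (hvY : B v Y < 0)
    (hw : B w w ≤ 0) (hwY : B w Y < 0) : B v w < 0 := by
  -- This combination is orthogonal to `Y`, hence spacelike or zero; expanding its square isolates
  -- `B v w`.
  have hu : 0 ≤ B (B w Y • v - B v Y • w) (B w Y • v - B v Y • w) := by
    by_cases h0 : B w Y • v - B v Y • w = 0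
    · rw [h0]; simp
    · exact (h.pos _ (by simp; ring) h0).le
  simp only [map_sub, map_smul, sub_apply, smul_apply,
    smul_eq_mul, h.symm w v] at hu
  have h1 : 0 < B v Y * B w Y := mul_pos_of_neg_of_neg hvY hwY
  have h2 : B w Y * (B w Y * B v v) < 0 := by
    rw [← mul_assoc]; exact mul_neg_of_pos_of_neg (mul_pos_of_neg_of_neg hwY hwY) hv
  have h3 : B v Y * (B v Y * B w w) ≤ 0 := by
    rw [← mul_assoc]
    exact mul_nonpos_of_nonneg_of_nonpos (mul_pos_of_neg_of_neg hvY hvY).le hw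
  by_contra hc
  have h4 : 0 ≤ (B v Y * B w Y) * B v w := mul_nonneg h1.le (not_lt.1 hc)
  nlinarith

theorem add_smul_neg (h : IsLorentzForm B Y) (hv : B v v ≤ 0) (hvY : B v Y < 0) {ε : ℝ}
    (hε : 0 < ε) : B (v + ε • Y) (v + ε • Y) < 0 ∧ B (v + ε • Y) Y < 0 := by
  simp only [map_add, map_smul, add_apply, smul_apply,
    smul_eq_mul, h.symm Y v]
  have h1 := mul_neg_of_pos_of_neg hε hvY
  have h2 := mul_neg_of_pos_of_neg hε h.neg
  have h3 := mul_neg_of_pos_of_neg hε h2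
  constructor <;> linarith

end IsLorentzForm

end LorentzForm

/-! ### The Gauss lemma in coordinates. -/

section Gauss

variable {E : Type*} [NormedAddCommGroup E] [NormedSpace ℝ E]

/-- The Gauss lemma in normal coordinates: if the rays through the origin are geodesics of the
metric `G`, then radial products are constant along rays. -/
theorem gauss_lemma_of_radial {G : E → E →L[ℝ] E →L[ℝ] ℝ} {s : Set E} (hs : IsOpen s)
    (hstar : StarConvex ℝ (0 : E) s) (hG : ∀ u ∈ s, DifferentiableAt ℝ G u)
    (hsymm : ∀ u a b, G u a b = G u b a)
    (hgeo : ∀ v ∈ s, ∀ t ∈ Icc (0 : ℝ) 1, ∀ z,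
      fderiv ℝ G (t • v) v v z = 1 / 2 * fderiv ℝ G (t • v) z v v)
    {v : E} (hv : v ∈ s) (w : E) : G v v w = G 0 v w := by
  have hmem : ∀ v ∈ s, ∀ t ∈ Icc (0 : ℝ) 1, t • v ∈ s := fun v hv t ht =>
    hstar.smul_mem hv ht.1 ht.2
  have hd : ∀ v ∈ s, ∀ t ∈ Icc (0 : ℝ) 1, ∀ a b,
      HasDerivAt (fun r : ℝ => G (r • v) a b) (fderiv ℝ G (t • v) v a b) t := by
    intro v hv t ht a b
    have h1 : HasDerivAt (fun r : ℝ => r • v) v t := by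
      simpa using (hasDerivAt_id t).smul_const v
    have h2 : HasDerivAt (fun r : ℝ => G (r • v)) (fderiv ℝ G (t • v) v) t :=
      HasFDerivAt.comp_hasDerivAt (F := E) (E := E →L[ℝ] E →L[ℝ] ℝ) t
        (hG _ (hmem v hv t ht)).hasFDerivAt h1
    exact (h2.clm_apply (hasDerivAt_const t a) |>.clm_apply (hasDerivAt_const t b)).congr_deriv
      (by simp)
  -- Radial geodesics have constant energy: `hgeo` with `z = u` makes the derivative equal to half
  -- of itself.
  have energy : ∀ u ∈ s, ∀ t ∈ Icc (0 : ℝ) 1, G (t • u) u u = G 0 u u := by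
    intro u hu t ht
    have := constant_of_has_deriv_right_zero (f := fun r : ℝ => G (r • u) u u) (a := 0) (b := 1)
      (fun r hr => (hd u hu r hr u u).continuousAt.continuousWithinAt)
      (fun r hr => by
        have h0 : fderiv ℝ G (r • u) u u u = 0 := by
          have := hgeo u hu r ⟨hr.1, hr.2.le⟩ u; linarith
        have := (hd u hu r ⟨hr.1, hr.2.le⟩ u u).hasDerivWithinAt (s := Ici r)
        rwa [h0] at this) t ht
    simpa using this
  -- The derivative at `r = 0` of the energy identity for the rays `v + r • w`.
  have var : ∀ t ∈ Icc (0 : ℝ) 1,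
      t * fderiv ℝ G (t • v) w v v + 2 * G (t • v) v w = 2 * G 0 v w := by
    intro t ht
    have e1 : (fun r : ℝ => G (t • (v + r • w)) (v + r • w) (v + r • w)) =ᶠ[𝓝 0]
        fun r : ℝ => G 0 (v + r • w) (v + r • w) := by
      have hc : Continuous fun r : ℝ => v + r • w := by fun_prop
      have : ∀ᶠ r in 𝓝 (0 : ℝ), v + r • w ∈ s :=
        hc.continuousAt.eventually_mem (hs.mem_nhds (by simpa using hv))
      filter_upwards [this] with r hr using energy _ hr t ht
    have hl : HasDerivAt (fun r : ℝ => v + r • w) w 0 := by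
      simpa using ((hasDerivAt_id (0 : ℝ)).smul_const w).const_add v
    have hl' : HasDerivAt (fun r : ℝ => t • (v + r • w)) (t • w) 0 := hl.const_smul t
    have hGt : HasFDerivAt G (fderiv ℝ G (t • v)) (t • (v + (0 : ℝ) • w)) := by
      simpa using (hG _ (hmem v hv t ht)).hasFDerivAt
    have d0 : HasDerivAt (fun r : ℝ => G (t • (v + r • w))) (fderiv ℝ G (t • v) (t • w)) 0 :=
      HasFDerivAt.comp_hasDerivAt (F := E) (E := E →L[ℝ] E →L[ℝ] ℝ) (0 : ℝ) hGt hl'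
    have d1 := (d0.clm_apply hl).clm_apply hl
    have d2 := (((hasDerivAt_const (0 : ℝ) (G 0)).clm_apply hl)).clm_apply hl
    have := (d1.congr_of_eventuallyEq e1.symm).unique d2
    simp [hsymm _ w v] at this
    linarith
  -- By `hgeo` and `var`, the derivative of `r * G (r • v) v w` is the constant `G 0 v w`.
  have main := constant_of_has_deriv_right_zero
    (f := fun r : ℝ => r * G (r • v) v w - r * G 0 v w) (a := 0) (b := 1)
    (fun r hr => ((((hasDerivAt_id r).mul (hd v hv r hr v w)).sub
      ((hasDerivAt_id r).mul_const (G 0 v w))).continuousAt.continuousWithinAt))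
    (fun r hr => by
      have hr' : r ∈ Icc (0 : ℝ) 1 := ⟨hr.1, hr.2.le⟩
      have := (((hasDerivAt_id r).mul (hd v hv r hr' v w)).sub
        ((hasDerivAt_id r).mul_const (G 0 v w))).hasDerivWithinAt (s := Ici r)
      refine this.congr_deriv ?_
      rw [hgeo v hv r hr' w]
      have := var r hr'
      simp only [id]
      linarith) 1 ⟨zero_le_one, le_rfl⟩
  simp at main
  linarith

/-- Change of coordinates for the geodesic equation: if the image of a ray under `Φ` solves the
geodesic equation of `G` at `Φ u`, the ray itself solves that of the pullback `K` of `G`. -/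
theorem radial_of_pullback {G K : E → E →L[ℝ] E →L[ℝ] ℝ} {Φ : E → E} {u v : E}
    (hΦ : ContDiffAt ℝ 2 Φ u) (hG : DifferentiableAt ℝ G (Φ u))
    (hsymm : ∀ u a b, G u a b = G u b a)
    (hK : ∀ᶠ x in 𝓝 u, ∀ a b, K x a b = G (Φ x) (fderiv ℝ Φ x a) (fderiv ℝ Φ x b))
    (hKd : DifferentiableAt ℝ K u)
    (hgeo : ∀ z, G (Φ u) (fderiv ℝ (fderiv ℝ Φ) u v v) z +
      christoffelFirst G (Φ u) (fderiv ℝ Φ u v) (fderiv ℝ Φ u v) z = 0) (z : E) :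
    fderiv ℝ K u v v z = 1 / 2 * fderiv ℝ K u z v v := by
  have hΦ1 : DifferentiableAt ℝ Φ u := hΦ.differentiableAt (by norm_num)
  have hΦ2 : DifferentiableAt ℝ (fderiv ℝ Φ) u :=
    (hΦ.fderiv_right (m := 1) (by norm_num)).differentiableAt (by norm_num)
  have hsd : ∀ a b, fderiv ℝ (fderiv ℝ Φ) u a b = fderiv ℝ (fderiv ℝ Φ) u b a := fun a b =>
    (hΦ.isSymmSndFDerivAt (by simp)) a b
  -- Product rule for the pullback. In the final identity the terms with the mixed second derivative
  -- of `Φ` in `v` and `z` cancel by symmetry, leaving `hgeo` tested on the image of `z`.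
  have key : ∀ c a b, fderiv ℝ K u c a b =
      fderiv ℝ G (Φ u) (fderiv ℝ Φ u c) (fderiv ℝ Φ u a) (fderiv ℝ Φ u b)
        + G (Φ u) (fderiv ℝ (fderiv ℝ Φ) u c a) (fderiv ℝ Φ u b)
        + G (Φ u) (fderiv ℝ Φ u a) (fderiv ℝ (fderiv ℝ Φ) u c b) := by
    intro c a b
    have h1 : HasFDerivAt (fun x => K x a b) _ u :=
      (hKd.hasFDerivAt.clm_apply (hasFDerivAt_const a u)).clm_apply (hasFDerivAt_const b u)
    have hGc : HasFDerivAt (fun x => G (Φ x)) ((fderiv ℝ G (Φ u)).comp (fderiv ℝ Φ u)) u :=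
      HasFDerivAt.comp (F := E) (G := E →L[ℝ] E →L[ℝ] ℝ) u hG.hasFDerivAt hΦ1.hasFDerivAt
    have ha := hΦ2.hasFDerivAt.clm_apply (hasFDerivAt_const a u)
    have hb := hΦ2.hasFDerivAt.clm_apply (hasFDerivAt_const b u)
    have h2 := (hGc.clm_apply ha).clm_apply hb
    have h3 := (h2.congr_of_eventuallyEq (hK.mono fun x hx => hx a b)).unique h1
    have := congrArg (fun f => f c) h3
    simp at this
    rw [← this]; ring
  have hG' : ∀ c a b, fderiv ℝ G (Φ u) c a b = fderiv ℝ G (Φ u) c b a := by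
    intro c a b
    have h1 := (hG.hasFDerivAt.clm_apply (hasFDerivAt_const a _)).clm_apply
      (hasFDerivAt_const b _)
    have h2 := (hG.hasFDerivAt.clm_apply (hasFDerivAt_const b _)).clm_apply
      (hasFDerivAt_const a _)
    have h3 := (h1.congr_of_eventuallyEq (f₁ := fun x => G x b a)
      (.of_forall fun x => hsymm _ _ _)).unique h2
    simpa using congrArg (fun f => f c) h3
  rw [key, key]
  have := hgeo (fderiv ℝ Φ u z)
  simp [christoffelFirst] at this
  rw [hsd z v, hsymm _ (fderiv ℝ Φ u v) (fderiv ℝ (fderiv ℝ Φ) u v z)]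
  linarith [hG' (fderiv ℝ Φ u v) (fderiv ℝ Φ u v) (fderiv ℝ Φ u z),
    hG' (fderiv ℝ Φ u z) (fderiv ℝ Φ u v) (fderiv ℝ Φ u v)]

end Gauss

/-! ### Normal charts and the Gauss lemma on a manifold. -/

section NormalChart

variable {E : Type*} [NormedAddCommGroup E] [NormedSpace ℝ E]
  {H : Type*} [TopologicalSpace H] {I : ModelWithCorners ℝ E H}
  {M : Type*} [TopologicalSpace M] [ChartedSpace H M]

/-- The bilinear form on the model space given by a field of bilinear forms at a point. -/
def formAt (g : BilinField I M) (x : M) : E →L[ℝ] E →L[ℝ] ℝ := g x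

/-- The derivative of a map from the model space to a manifold, as an endomorphism of the model
space. -/
def modelDeriv (I : ModelWithCorners ℝ E H) (f : E → M) (u : E) : E →L[ℝ] E :=
  mfderiv 𝓘(ℝ, E) I f u

/-- The pullback of a field of bilinear forms by a map defined on the model space. -/
def pullback (g : BilinField I M) (f : E → M) (u : E) : E →L[ℝ] E →L[ℝ] ℝ :=
  (formAt g (f u)).bilinearComp (modelDeriv I f u) (modelDeriv I f u)

theorem pullback_apply (g : BilinField I M) (f : E → M) (u a b : E) :
    pullback g f u a b = formAt g (f u) (modelDeriv I f u a) (modelDeriv I f u b) := rfl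

theorem coordMetric_eq_pullback (g : BilinField I M) (x : M) :
    coordMetric g x = pullback g (extChartAt I x).symm := rfl

theorem pullback_congr (g : BilinField I M) {f f' : E → M} {u : E} (h : f =ᶠ[𝓝 u] f') :
    pullback g f u = pullback g f' u := by
  have h1 : f u = f' u := h.eq_of_nhds
  have h2 : modelDeriv I f u = modelDeriv I f' u := h.mfderiv_eq
  rw [pullback, pullback, h1, h2]

theorem modelDeriv_comp {f : E → M} {Φ : E → E} {u : E}
    (hf : MDifferentiableAt 𝓘(ℝ, E) I f (Φ u)) (hΦ : DifferentiableAt ℝ Φ u) :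
    modelDeriv I (fun x => f (Φ x)) u = (modelDeriv I f (Φ u)).comp (fderiv ℝ Φ u) :=
  (hf.hasMFDerivAt.comp u hΦ.hasFDerivAt.hasMFDerivAt).mfderiv

theorem pullback_comp (g : BilinField I M) {f : E → M} {Φ : E → E} {u : E}
    (hf : MDifferentiableAt 𝓘(ℝ, E) I f (Φ u)) (hΦ : DifferentiableAt ℝ Φ u) (a b : E) :
    pullback g (fun x => f (Φ x)) u a b
      = pullback g f (Φ u) (fderiv ℝ Φ u a) (fderiv ℝ Φ u b) := by
  rw [pullback_apply, modelDeriv_comp hf hΦ]; rfl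

/-- A semi-Riemannian metric, with as much regularity as the geodesic equation needs. -/
structure IsMetric (g : BilinField I M) : Prop where
  symm : ∀ x v w, formAt g x v w = formAt g x w v
  nondegenerate : ∀ x v, (∀ w, formAt g x v w = 0) → v = 0
  smooth : ∀ (f : E → M) (u : E), ContMDiffAt 𝓘(ℝ, E) I ∞ f u →
    DifferentiableAt ℝ (pullback g f) u

/-- `e` is a normal chart at `x`: the exponential map at `x` on a star-shaped open set. -/
structure IsNormalChart (g : BilinField I M) (e : OpenPartialHomeomorph E M) (x : M) : Prop where
  zero_mem : (0 : E) ∈ e.source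
  star : StarConvex ℝ (0 : E) e.source
  map_zero : e 0 = x
  smooth : ContMDiffOn 𝓘(ℝ, E) I ∞ e e.source
  smooth_symm : ContMDiffOn I 𝓘(ℝ, E) ∞ e.symm e.target
  geodesic : ∀ v ∈ e.source, IsGeodesic g (fun s : ℝ => e (s • v)) 0 1
  velocity : ∀ v ∈ e.source, Spacetime.velocity I (fun s : ℝ => e (s • v)) (Icc 0 1) 0 = v

theorem IsNormalNhd.exists_chart {g : BilinField I M} {U : Set M} {x : M}
    (h : IsNormalNhd g U x) :
    ∃ e : OpenPartialHomeomorph E M, e.target = U ∧ IsNormalChart g e x := by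
  obtain ⟨e, h1, h2, h3, h4, h5, h6, h7⟩ := h
  exact ⟨e, h1, h2, h3, h4, h5, h6, fun v hv => (h7 v hv).1, fun v hv => (h7 v hv).2⟩

namespace IsMetric

variable {g : BilinField I M} [FiniteDimensional ℝ E] [I.Boundaryless] [IsManifold I ∞ M]

/-- `ContinuousLinearMap.inverse` is zero on non-invertible maps, so raising the index is meaningful
only once the metric is known to be invertible: nondegeneracy gives injectivity, and finite
dimension the rest. -/
theorem coordMetric_christoffel (hg : IsMetric g) (x : M) {u : E}
    (hu : u ∈ (extChartAt I x).target) (v w z : E) :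
    coordMetric g x u (christoffel (coordMetric g x) u v w) z
      = christoffelFirst (coordMetric g x) u v w z := by
  obtain ⟨A, hA⟩ : ∃ A : E ≃L[ℝ] E, (A : E →L[ℝ] E) = modelDeriv I (extChartAt I x).symm u := by
    have : IsManifold I 1 M := IsManifold.of_le (n := ∞) (by simp)
    have := isInvertible_mfderivWithin_extChartAt_symm (I := I) hu
    rw [I.range_eq_univ, mfderivWithin_univ] at this
    exact this
  have hinj : Function.Injective (coordMetric g x u) := by
    rw [injective_iff_map_eq_zero]
    intro a ha
    have h0 : A a = 0 := by
      refine hg.nondegenerate ((extChartAt I x).symm u) _ fun w => ?_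
      have := congrArg (fun f : E →L[ℝ] ℝ => f (A.symm w)) ha
      rw [coordMetric_eq_pullback] at this
      rw [pullback_apply, ← hA] at this
      simpa using this
    simpa using h0
  have hfin : Module.finrank ℝ E = Module.finrank ℝ (E →L[ℝ] ℝ) := by
    rw [← (LinearMap.toContinuousLinearMap (𝕜 := ℝ) (E := E) (F' := ℝ)).finrank_eq]
    exact (Subspace.dual_finrank_eq).symm
  let L := (LinearEquiv.ofInjectiveOfFinrankEq (coordMetric g x u : E →ₗ[ℝ] E →L[ℝ] ℝ)
    hinj hfin).toContinuousLinearEquiv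
  have hL : (L : E →L[ℝ] E →L[ℝ] ℝ) = coordMetric g x u := by
    ext a b; rfl
  rw [christoffel, ← hL, ContinuousLinearMap.inverse_equiv]
  simp

end IsMetric

namespace IsNormalChart

variable {g : BilinField I M} {e : OpenPartialHomeomorph E M} {x : M}

theorem smul_mem (h : IsNormalChart g e x) {v : E} (hv : v ∈ e.source) {t : ℝ}
    (ht : t ∈ Icc (0 : ℝ) 1) : t • v ∈ e.source :=
  h.star.smul_mem hv ht.1 ht.2

theorem contMDiffAt (h : IsNormalChart g e x) {v : E} (hv : v ∈ e.source) :
    ContMDiffAt 𝓘(ℝ, E) I ∞ e v :=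
  h.smooth.contMDiffAt (e.open_source.mem_nhds hv)

theorem mdifferentiableAt (h : IsNormalChart g e x) {v : E} (hv : v ∈ e.source) :
    MDifferentiableAt 𝓘(ℝ, E) I e v :=
  (h.contMDiffAt hv).mdifferentiableAt (by simp)

theorem velocity_ray (h : IsNormalChart g e x) {v : E} (hv : v ∈ e.source) {t : ℝ}
    (ht : t ∈ Icc (0 : ℝ) 1) :
    (Spacetime.velocity I (fun s : ℝ => e (s • v)) (Icc 0 1) t : E)
      = modelDeriv I e (t • v) v := by
  have h1 : HasDerivAt (fun r : ℝ => r • v) v t := by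
    simpa using (hasDerivAt_id t).smul_const v
  have h2 := (HasMFDerivAt.comp t (h.mdifferentiableAt (h.smul_mem hv ht)).hasMFDerivAt
    h1.hasFDerivAt.hasMFDerivAt).hasMFDerivWithinAt (s := Icc (0 : ℝ) 1)
  have hu : UniqueMDiffWithinAt 𝓘(ℝ, ℝ) (Icc (0 : ℝ) 1) t :=
    (uniqueDiffOn_Icc zero_lt_one t ht).uniqueMDiffWithinAt
  have h3 := h2.mfderivWithin hu
  have h4 := congrArg (fun f : ℝ →L[ℝ] E => f 1) h3
  refine h4.trans ?_
  change modelDeriv I e (t • v)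
    ((ContinuousLinearMap.toSpanSingleton ℝ v) (1 : ℝ)) = _
  simp

/-- The initial velocities give the identity on `e.source` only; every vector has a small positive
multiple there, and linearity concludes. -/
theorem mfderiv_zero (h : IsNormalChart g e x) :
    modelDeriv I e 0 = ContinuousLinearMap.id ℝ E := by
  have h0 : ∀ v ∈ e.source, modelDeriv I e 0 v = v := by
    intro v hv
    have h1 := h.velocity_ray hv (t := 0) (by simp)
    rw [zero_smul] at h1
    exact h1.symm.trans (h.velocity v hv)
  refine ContinuousLinearMap.ext fun w : E => ?_
  have hc : ContinuousAt (fun r : ℝ => r • w) 0 := by fun_prop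
  have hm : ∀ᶠ r in 𝓝[>] (0 : ℝ), r • w ∈ e.source :=
    (hc.eventually_mem (e.open_source.mem_nhds (by simpa using h.zero_mem))).filter_mono
      nhdsWithin_le_nhds
  obtain ⟨r, hr, hr0⟩ := (hm.and self_mem_nhdsWithin).exists
  have := h0 _ hr
  rw [map_smul] at this
  exact smul_right_injective E (ne_of_gt hr0) this

variable [FiniteDimensional ℝ E] [I.Boundaryless] [IsManifold I ∞ M]

/-- The geodesic equation of a ray, expressed in normal coordinates with the index lowered: the ray
is straight there, so only Christoffel terms remain. This is the hypothesis of
`gauss_lemma_of_radial`. -/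
theorem radial (hg : IsMetric g) (h : IsNormalChart g e x) {v : E} (hv : v ∈ e.source) {t : ℝ}
    (ht : t ∈ Icc (0 : ℝ) 1) (z : E) :
    fderiv ℝ (pullback g e) (t • v) v v z = 1 / 2 * fderiv ℝ (pullback g e) (t • v) z v v := by
  set u := t • v with hu
  have hus : u ∈ e.source := h.smul_mem hv ht
  set x₁ := e u with hx₁
  -- The transition from normal coordinates to the chart at `e u`, the one in which `acceleration`
  -- is computed at this parameter.
  let Φ : E → E := fun y => extChartAt I x₁ (e y)
  have hΦ' : ∀ y ∈ e.source, e y ∈ (chartAt H x₁).source → ContDiffAt ℝ ∞ Φ y := by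
    intro y hy hy'
    exact ((contMDiffAt_extChartAt' hy').comp y (h.contMDiffAt hy)).contDiffAt
  have hev : ∀ᶠ y in 𝓝 u, y ∈ e.source ∧ e y ∈ (chartAt H x₁).source :=
    (Filter.eventually_of_mem (e.open_source.mem_nhds hus) fun _ => id).and
      ((e.continuousAt hus).eventually_mem (chart_source_mem_nhds H x₁))
  have hΦ := hΦ' u hus (mem_chart_source H x₁)
  have hΦ2 : ContDiffAt ℝ 2 Φ u := mod_cast contDiffAt_infty.1 hΦ 2
  have htgt : Φ u ∈ (extChartAt I x₁).target := mem_extChartAt_target x₁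
  have hψ : ∀ y ∈ (extChartAt I x₁).target,
      ContMDiffAt 𝓘(ℝ, E) I ∞ (extChartAt I x₁).symm y := fun y hy =>
    (contMDiffOn_extChartAt_symm x₁).contMDiffAt ((isOpen_extChartAt_target x₁).mem_nhds hy)
  refine radial_of_pullback (G := coordMetric g x₁) (Φ := Φ) hΦ2
    (hg.smooth _ _ (hψ _ htgt)) (fun _ _ _ => hg.symm _ _ _) ?_ (hg.smooth _ _ (h.contMDiffAt hus))
    ?_ z
  · filter_upwards [hev.eventually_nhds] with y hy a b
    have hys := hy.self_of_nhds
    have heq : (e : E → M) =ᶠ[𝓝 y] fun z => (extChartAt I x₁).symm (Φ z) := by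
      filter_upwards [hy] with z hz
      exact ((extChartAt I x₁).left_inv (by rw [extChartAt_source]; exact hz.2)).symm
    rw [pullback_congr g heq, coordMetric_eq_pullback]
    exact pullback_comp g ((hψ _ ((extChartAt I x₁).map_source
      (by rw [extChartAt_source]; exact hys.2))).mdifferentiableAt (by simp))
      ((hΦ' y hys.1 hys.2).differentiableAt (by simp)) a b
  · intro z
    have hacc := (h.geodesic v hv).acceleration_eq_zero t ht
    have hray : ∀ r : ℝ, HasDerivAt (fun r : ℝ => r • v) v r := fun r => by
      simpa using (hasDerivAt_id r).smul_const v
    have hud : UniqueDiffOn ℝ (Icc (0 : ℝ) 1) := uniqueDiffOn_Icc zero_lt_one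
    have hd1 : ∀ r ∈ Icc (0 : ℝ) 1, ContDiffAt ℝ ∞ Φ (r • v) →
        derivWithin (fun r : ℝ => Φ (r • v)) (Icc 0 1) r = fderiv ℝ Φ (r • v) v := by
      intro r hr hd
      have := (hd.differentiableAt (by simp)).hasFDerivAt.comp_hasDerivAt r (hray r)
      exact this.hasDerivWithinAt.derivWithin (hud r hr)
    have hevt : ∀ᶠ r in 𝓝[Icc (0 : ℝ) 1] t,
        derivWithin (fun r : ℝ => Φ (r • v)) (Icc 0 1) r = fderiv ℝ Φ (r • v) v := by
      have h1 : ∀ᶠ r in 𝓝 t, r • v ∈ e.source ∧ e (r • v) ∈ (chartAt H x₁).source :=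
        (hray t).continuousAt.eventually hev
      filter_upwards [h1.filter_mono nhdsWithin_le_nhds, self_mem_nhdsWithin] with r hr hr'
      exact hd1 r hr' (hΦ' _ hr.1 hr.2)
    have hd2 : derivWithin (derivWithin (fun r : ℝ => Φ (r • v)) (Icc 0 1)) (Icc 0 1) t
        = fderiv ℝ (fderiv ℝ Φ) u v v := by
      have hD : DifferentiableAt ℝ (fderiv ℝ Φ) (t • v) :=
        (hΦ2.fderiv_right (m := 1) (by norm_num)).differentiableAt (by norm_num)
      have h1 : HasDerivAt (fun r : ℝ => fderiv ℝ Φ (r • v)) (fderiv ℝ (fderiv ℝ Φ) (t • v) v) t :=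
        HasFDerivAt.comp_hasDerivAt (F := E) (E := E →L[ℝ] E) t hD.hasFDerivAt (hray t)
      have h2 := (h1.clm_apply (hasDerivAt_const t v)).hasDerivWithinAt (s := Icc (0 : ℝ) 1)
      have h3 := h2.congr_of_eventuallyEq hevt (hevt.self_of_nhdsWithin ht)
      simpa using h3.derivWithin (hud t ht)
    change derivWithin (derivWithin (fun r : ℝ => Φ (r • v)) (Icc 0 1)) (Icc 0 1) t
      + christoffel (coordMetric g x₁) (Φ (t • v))
        (derivWithin (fun r : ℝ => Φ (r • v)) (Icc 0 1) t)
        (derivWithin (fun r : ℝ => Φ (r • v)) (Icc 0 1) t) = 0 at hacc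
    rw [hd2, hd1 t ht hΦ] at hacc
    have := congrArg (fun y => coordMetric g x₁ (Φ u) y z) hacc
    simp only [map_add, add_apply] at this
    rw [hg.coordMetric_christoffel x₁ htgt] at this
    exact this.trans (by rw [ContinuousLinearMap.map_zero]; rfl)

/-- The Gauss lemma. -/
theorem gauss (hg : IsMetric g) (h : IsNormalChart g e x) {v : E} (hv : v ∈ e.source) (w : E) :
    formAt g (e v) (modelDeriv I e v v) (modelDeriv I e v w) = formAt g x v w := by
  have h1 := gauss_lemma_of_radial e.open_source h.star
    (fun u hu => hg.smooth e u (h.contMDiffAt hu)) (fun _ _ _ => hg.symm _ _ _)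
    (fun v hv t ht z => radial hg h hv ht z) hv w
  rw [pullback_apply, pullback_apply, h.mfderiv_zero, h.map_zero] at h1
  exact h1

end IsNormalChart

end NormalChart

/-! ### Affine reparametrization, including reversal of time. -/

section Reparametrization

open scoped Pointwise

variable {E : Type*} [NormedAddCommGroup E] [NormedSpace ℝ E]
  {H : Type*} [TopologicalSpace H] {I : ModelWithCorners ℝ E H}
  {M : Type*} [TopologicalSpace M] [ChartedSpace H M]

theorem derivWithin_comp_affine (f : ℝ → E) {k m : ℝ} {J J' : Set ℝ} (hJ : J = m +ᵥ k • J')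
    (s : ℝ) :
    derivWithin (fun r => f (k * r + m)) J' s = k • derivWithin f J (k * s + m) := by
  rw [derivWithin_comp_mul_left k (fun x => f (x + m)), derivWithin_comp_add_const, hJ]

theorem mapsTo_affine {k m : ℝ} {J J' : Set ℝ} (hJ : J = m +ᵥ k • J') :
    MapsTo (fun r : ℝ => k * r + m) J' J := by
  intro r hr
  rw [hJ]
  exact ⟨k * r, ⟨r, hr, rfl⟩, add_comm _ _⟩

theorem contMDiff_affine (k m : ℝ) : ContMDiff 𝓘(ℝ, ℝ) 𝓘(ℝ, ℝ) ∞ fun r : ℝ => k * r + m := by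
  have : ContDiff ℝ ∞ fun r : ℝ => k * r + m := by fun_prop
  exact this.contMDiff

theorem velocity_comp_affine {γ : ℝ → M} {k m : ℝ} {J J' : Set ℝ} (hJ : J = m +ᵥ k • J') {s : ℝ}
    (hu : UniqueDiffWithinAt ℝ J' s)
    (hγ : MDifferentiableWithinAt 𝓘(ℝ, ℝ) I γ J (k * s + m)) :
    velocity I (fun r => γ (k * r + m)) J' s = k • velocity I γ J (k * s + m) := by
  have h1 : HasDerivWithinAt (fun r : ℝ => k * r + m) k J' s := by
    simpa using (((hasDerivAt_id s).const_mul k).add_const m).hasDerivWithinAt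
  have h2 := (hγ.hasMFDerivWithinAt.comp s h1.hasFDerivWithinAt.hasMFDerivWithinAt
    (mapsTo_affine hJ)).mfderivWithin hu.uniqueMDiffWithinAt
  have h3 := congrArg (fun f : ℝ →L[ℝ] E => f 1) h2
  refine h3.trans ?_
  let D : ℝ →L[ℝ] E := mfderivWithin 𝓘(ℝ, ℝ) I γ J (k * s + m)
  change D (ContinuousLinearMap.toSpanSingleton ℝ k (1 : ℝ)) = k • D 1
  rw [← map_smul]
  simp

theorem acceleration_comp_affine (g : BilinField I M) (γ : ℝ → M) {k m : ℝ} {J J' : Set ℝ}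
    (hJ : J = m +ᵥ k • J') (s : ℝ) :
    acceleration g (fun r => γ (k * r + m)) J' s = (k ^ 2) • acceleration g γ J (k * s + m) := by
  let c : ℝ → E := fun r => extChartAt I (γ (k * s + m)) (γ r)
  change (derivWithin (derivWithin (fun r => c (k * r + m)) J') J' s
    + christoffel (coordMetric g (γ (k * s + m))) (c (k * s + m))
      (derivWithin (fun r => c (k * r + m)) J' s) (derivWithin (fun r => c (k * r + m)) J' s) : E)
    = (k ^ 2) • (derivWithin (derivWithin c J) J (k * s + m)
    + christoffel (coordMetric g (γ (k * s + m))) (c (k * s + m))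
      (derivWithin c J (k * s + m)) (derivWithin c J (k * s + m)) : E)
  have h1 : derivWithin (fun r => c (k * r + m)) J' = fun r => k • derivWithin c J (k * r + m) :=
    funext fun r => derivWithin_comp_affine c hJ r
  have h2 : derivWithin (fun r => k • derivWithin c J (k * r + m)) J' s
      = k • k • derivWithin (derivWithin c J) J (k * s + m) := by
    rw [← derivWithin_comp_affine (derivWithin c J) hJ s]
    exact derivWithin_const_smul_field k _
  have h3 : ∀ (G : E → E →L[ℝ] E →L[ℝ] ℝ) (u v : E),
      christoffel G u (k • v) (k • v) = (k ^ 2) • christoffel G u v v := by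
    intro G u v
    have : christoffelFirst G u (k • v) (k • v) = (k ^ 2) • christoffelFirst G u v v := by
      ext z
      simp [christoffelFirst]
      ring
    rw [christoffel, this, map_smul, christoffel]
  rw [h1, h2, h3, smul_add, smul_smul, sq]

theorem IsGeodesic.comp_affine {g : BilinField I M} {γ : ℝ → M} {a b a' b' k m : ℝ}
    (h : IsGeodesic g γ a b) (hJ : Icc a b = m +ᵥ k • Icc a' b') :
    IsGeodesic g (fun r => γ (k * r + m)) a' b' where
  smooth := h.smooth.comp (contMDiff_affine k m).contMDiffOn (mapsTo_affine hJ)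
  acceleration_eq_zero s hs := by
    rw [acceleration_comp_affine g γ hJ, h.acceleration_eq_zero _ (mapsTo_affine hJ hs), smul_zero]

theorem IsLightlike.smul {g : BilinField I M} {x : M} {v : TangentSpace I x} (h : IsLightlike g x v)
    {k : ℝ} (hk : k ≠ 0) : IsLightlike g x (k • v) :=
  ⟨smul_ne_zero hk h.1, by simp [h.2]⟩

theorem IsNonSpacelike.smul {g : BilinField I M} {x : M} {v : TangentSpace I x}
    (h : IsNonSpacelike g x v) {k : ℝ} (hk : k ≠ 0) : IsNonSpacelike g x (k • v) :=
  ⟨smul_ne_zero hk h.1, by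
    simp only [map_smul, smul_apply, smul_eq_mul, ← mul_assoc]
    exact mul_nonpos_of_nonneg_of_nonpos (mul_self_nonneg k) h.2⟩

theorem IsFuturePointing.smul {g : BilinField I M} {Y Y' : ∀ x : M, TangentSpace I x} {x : M}
    {v : TangentSpace I x} (h : IsFuturePointing g Y x v) {k : ℝ} (hk : k ≠ 0)
    (hY : Y' x = k • Y x) : IsFuturePointing g Y' x (k • v) := by
  rw [IsFuturePointing, hY]
  simp only [map_smul, smul_apply, smul_eq_mul, ← mul_assoc]
  exact mul_neg_of_pos_of_neg (mul_self_pos.2 hk) h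

/-- Velocities are multiplied by `k`, so scaling the orienting field by `k` too keeps the curve
future-pointing. The uses are `k = -1`, which reverses curve and orientation together, and `k = 1`,
a translation. -/
theorem IsLightlikeGeodesic.comp_affine {g : BilinField I M} {Y Y' : ∀ x : M, TangentSpace I x}
    {γ : ℝ → M} {a b a' b' k m : ℝ} (h : IsLightlikeGeodesic g Y γ a b) (hlt : a' < b')
    (hk : k ≠ 0) (hJ : Icc a b = m +ᵥ k • Icc a' b') (hY : ∀ x, Y' x = k • Y x) :
    IsLightlikeGeodesic g Y' (fun r => γ (k * r + m)) a' b' := by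
  have hv : ∀ s ∈ Icc a' b', velocity I (fun r => γ (k * r + m)) (Icc a' b') s
      = k • velocity I γ (Icc a b) (k * s + m) := fun s hs =>
    velocity_comp_affine hJ (uniqueDiffOn_Icc hlt s hs)
      ((h.geodesic.smooth _ (mapsTo_affine hJ hs)).mdifferentiableWithinAt (by simp))
  refine ⟨hlt, h.geodesic.comp_affine hJ, fun s hs => ?_, fun s hs => ?_⟩
  · rw [hv s hs]
    exact (h.lightlike _ (mapsTo_affine hJ hs)).smul hk
  · rw [hv s hs]
    exact (h.future _ (mapsTo_affine hJ hs)).smul hk (hY _)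

theorem IsSmoothCausalCurve.comp_affine {g : BilinField I M} {Y Y' : ∀ x : M, TangentSpace I x}
    {γ : ℝ → M} {a b a' b' k m : ℝ} (h : IsSmoothCausalCurve g Y γ a b) (hlt : a' < b')
    (hk : k ≠ 0) (hJ : Icc a b = m +ᵥ k • Icc a' b') (hY : ∀ x, Y' x = k • Y x) :
    IsSmoothCausalCurve g Y' (fun r => γ (k * r + m)) a' b' := by
  have hv : ∀ s ∈ Icc a' b', velocity I (fun r => γ (k * r + m)) (Icc a' b') s
      = k • velocity I γ (Icc a b) (k * s + m) := fun s hs =>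
    velocity_comp_affine hJ (uniqueDiffOn_Icc hlt s hs)
      ((h.smooth _ (mapsTo_affine hJ hs)).mdifferentiableWithinAt (by simp))
  refine ⟨hlt, h.smooth.comp (contMDiff_affine k m).contMDiffOn (mapsTo_affine hJ),
    fun s hs => ?_, fun s hs => ?_⟩
  · rw [hv s hs]
    exact (h.nonSpacelike _ (mapsTo_affine hJ hs)).smul hk
  · rw [hv s hs]
    exact (h.future _ (mapsTo_affine hJ hs)).smul hk (hY _)

theorem Icc_eq_vadd_neg_one_smul (a b : ℝ) : Icc a b = (0 : ℝ) +ᵥ (-1 : ℝ) • Icc (-b) (-a) := by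
  simp

theorem Icc_eq_vadd_one_smul (a b m : ℝ) :
    Icc a b = m +ᵥ (1 : ℝ) • Icc (a - m) (b - m) := by
  simp [← image_vadd]

theorem velocity_congr {γ γ' : ℝ → M} {J : Set ℝ} (h : EqOn γ' γ J) {s : ℝ} (hs : s ∈ J) :
    (velocity I γ' J s : E) = velocity I γ J s :=
  congrArg (fun f : ℝ →L[ℝ] E => f 1) (mfderivWithin_congr h (h hs))

theorem IsLightlikeGeodesic.congr {g : BilinField I M} {Y : ∀ x : M, TangentSpace I x}
    {γ γ' : ℝ → M} {a b : ℝ} (h : IsLightlikeGeodesic g Y γ a b) (heq : EqOn γ' γ (Icc a b)) :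
    IsLightlikeGeodesic g Y γ' a b := by
  let Z : M → E := Y
  refine ⟨h.lt, ⟨h.geodesic.smooth.congr heq, fun s hs => ?_⟩, fun s hs => ?_, fun s hs => ?_⟩
  · refine Eq.trans ?_ (h.geodesic.acceleration_eq_zero s hs)
    -- The acceleration with the base point of the chart as a separate argument and values in the
    -- fixed space `E`, so that `γ' s = γ s` can be rewritten.
    let A : M → (ℝ → M) → E := fun x σ =>
      derivWithin (derivWithin (fun r => extChartAt I x (σ r)) (Icc a b)) (Icc a b) s
        + christoffel (coordMetric g x) (extChartAt I x (σ s))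
          (derivWithin (fun r => extChartAt I x (σ r)) (Icc a b) s)
          (derivWithin (fun r => extChartAt I x (σ r)) (Icc a b) s)
    change A (γ' s) γ' = A (γ s) γ
    rw [heq hs]
    have h1 : EqOn (fun r => extChartAt I (γ s) (γ' r)) (fun r => extChartAt I (γ s) (γ r))
        (Icc a b) := fun r hr => by simp only [heq hr]
    have h2 : EqOn (derivWithin (fun r => extChartAt I (γ s) (γ' r)) (Icc a b))
        (derivWithin (fun r => extChartAt I (γ s) (γ r)) (Icc a b)) (Icc a b) :=
      fun r hr => derivWithin_congr h1 (h1 hr)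
    simp only [A]
    rw [derivWithin_congr h2 (h2 hs), h2 hs, heq hs]
  · have h1 := h.lightlike s hs
    change (velocity I γ' (Icc a b) s : E) ≠ 0 ∧ formAt g (γ' s) (velocity I γ' (Icc a b) s : E)
      (velocity I γ' (Icc a b) s : E) = 0
    rw [velocity_congr heq hs, heq hs]
    exact h1
  · have h1 := h.future s hs
    change formAt g (γ' s) (velocity I γ' (Icc a b) s : E) (Z (γ' s)) < 0
    rw [velocity_congr heq hs, heq hs]
    exact h1

end Reparametrization

/-! ### Concatenation of lightlike geodesics. -/

section Chains

variable {E : Type*} [NormedAddCommGroup E] [NormedSpace ℝ E]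
  {H : Type*} [TopologicalSpace H] {I : ModelWithCorners ℝ E H}
  {M : Type*} [TopologicalSpace M] [ChartedSpace H M]

/-- `p` and `q` are joined by a future-pointing lightlike geodesic. -/
def NullRelated (g : BilinField I M) (Y : ∀ x : M, TangentSpace I x) (p q : M) : Prop :=
  ∃ (γ : ℝ → M) (a b : ℝ), IsLightlikeGeodesic g Y γ a b ∧ γ a = p ∧ γ b = q

theorem NullRelated.reverse {g : BilinField I M} {Y Y' : ∀ x : M, TangentSpace I x} {p q : M}
    (h : NullRelated g Y p q) (hY : ∀ x, Y' x = (-1 : ℝ) • Y x) : NullRelated g Y' q p := by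
  obtain ⟨γ, a, b, hγ, rfl, rfl⟩ := h
  exact ⟨_, -b, -a, hγ.comp_affine (neg_lt_neg hγ.lt) (by norm_num)
    (Icc_eq_vadd_neg_one_smul a b) hY, by simp, by simp⟩

/-- Concatenation of lightlike geodesics. -/
theorem exists_piecewise_of_transGen {g : BilinField I M} {Y : ∀ x : M, TangentSpace I x} {p q : M}
    (h : Relation.TransGen (NullRelated g Y) p q) :
    ∃ (γ : ℝ → M) (a b : ℝ), IsPiecewiseLightlikeGeodesic g Y γ a b ∧ γ a = p ∧ γ b = q := by
  induction h with
  | single h =>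
    obtain ⟨γ, a, b, hγ, hp, hq⟩ := h
    refine ⟨γ, a, b, ⟨hγ.geodesic.smooth.continuousOn, 0, ![a, b], ?_, rfl, rfl, ?_⟩, hp, hq⟩
    · rw [Fin.strictMono_iff_lt_succ]
      intro i
      fin_cases i
      exact hγ.lt
    · intro i
      fin_cases i
      exact hγ
  | tail _ h ih =>
    obtain ⟨γ₁, a, b, ⟨hc, n, τ, hτ, hτa, hτb, hτi⟩, hp, hb⟩ := ih
    obtain ⟨γ₂, c, d, hγ₂, hc₂, hd₂⟩ := h
    -- The new piece is translated to start at the parameter `b` where the chain ends. Velocities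
    -- are one-sided on each piece, so corners are harmless.
    have hγ₃ := hγ₂.comp_affine (Y' := Y) (a' := c - (c - b)) (b' := d - (c - b))
      (by linarith [hγ₂.lt]) one_ne_zero (Icc_eq_vadd_one_smul c d (c - b)) (by simp)
    have hab : a < b := by
      rw [← hτa, ← hτb]; exact hτ (Fin.last_pos)
    have hcb : c - (c - b) = b := by ring
    rw [hcb] at hγ₃
    set e := d - (c - b) with he
    let γ : ℝ → M := fun s => if s ≤ b then γ₁ s else γ₂ (1 * s + (c - b))
    have h1 : EqOn γ γ₁ (Iic b) := fun s hs => if_pos hs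
    have h2 : EqOn γ (fun s => γ₂ (1 * s + (c - b))) (Ici b) := by
      intro s hs
      rcases eq_or_lt_of_le (mem_Ici.1 hs) with rfl | hs'
      · rw [h1 (mem_Iic.2 le_rfl), hb, ← hc₂]; congr 1; ring
      · exact if_neg hs'.not_ge
    have hγe : IsLightlikeGeodesic g Y γ b e := hγ₃.congr (h2.mono Icc_subset_Ici_self)
    refine ⟨γ, a, e, ⟨?_, n + 1, Fin.snoc τ e, ?_, ?_, ?_, ?_⟩, ?_, ?_⟩
    · rw [← Icc_union_Icc_eq_Icc hab.le hγe.lt.le]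
      exact (hc.congr (h1.mono Icc_subset_Iic_self)).union_of_isClosed
        hγe.geodesic.smooth.continuousOn isClosed_Icc isClosed_Icc
    · rw [Fin.strictMono_iff_lt_succ]
      intro i
      induction i using Fin.lastCases with
      | last =>
        rw [Fin.succ_last, Fin.snoc_last, Fin.snoc_castSucc, hτb]
        exact hγe.lt
      | cast i =>
        rw [Fin.succ_castSucc, Fin.snoc_castSucc, Fin.snoc_castSucc]
        exact hτ (Fin.castSucc_lt_succ)
    · rw [← hτa]
      exact Fin.snoc_castSucc (α := fun _ => ℝ) e τ 0
    · exact Fin.snoc_last (α := fun _ => ℝ) e τ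
    · intro i
      induction i using Fin.lastCases with
      | last =>
        rw [Fin.succ_last, Fin.snoc_last, Fin.snoc_castSucc, hτb]
        exact hγe
      | cast i =>
        rw [Fin.succ_castSucc, Fin.snoc_castSucc, Fin.snoc_castSucc]
        refine (hτi i).congr (h1.mono fun s hs => hs.2.trans ?_)
        rw [← hτb]
        exact hτ.monotone (Fin.le_last _)
    · rw [h1 hab.le, hp]
    · rw [h2 hγe.lt.le, ← hd₂]
      exact congrArg γ₂ (by rw [he]; ring)

end Chains

/-! ### From local to global along an interval. -/

section RealInduction

/-- A transitive relation that holds near the diagonal on `[a, b]`, between each fixed parameter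
and its neighbours, relates the end points. -/
theorem relates_endpoints_of_locally {R : ℝ → ℝ → Prop} (hrefl : ∀ s, R s s)
    (htrans : ∀ r s t, R r s → R s t → R r t) {a b : ℝ} (hab : a ≤ b)
    (hloc : ∀ s ∈ Icc a b, ∀ᶠ r in 𝓝[Icc a b] s, (s < r → R s r) ∧ (r < s → R r s)) :
    R a b := by
  let A : Set ℝ := {s ∈ Icc a b | R a s}
  have haA : a ∈ A := ⟨left_mem_Icc.2 hab, hrefl a⟩
  have hbdd : BddAbove A := ⟨b, fun s hs => hs.1.2⟩
  set c := sSup A with hc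
  have hac : a ≤ c := le_csSup hbdd haA
  have hcb : c ≤ b := csSup_le ⟨a, haA⟩ fun s hs => hs.1.2
  obtain ⟨u, hu, hu'⟩ := mem_nhdsWithin_iff_exists_mem_nhds_inter.1 (hloc c ⟨hac, hcb⟩)
  obtain ⟨ε, hε, hball⟩ := Metric.mem_nhds_iff.1 hu
  have hnear : ∀ r ∈ Icc a b, |r - c| < ε → (c < r → R c r) ∧ (r < c → R r c) := fun r hr hrε =>
    hu' ⟨hball (by simpa [Real.dist_eq] using hrε), hr⟩
  -- The supremum is reached using left neighbours of `c`; right neighbours then show that it cannot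
  -- be smaller than `b`.
  have hRc : R a c := by
    obtain ⟨r, hr, hrc⟩ := exists_lt_of_lt_csSup ⟨a, haA⟩ (sub_lt_self c hε)
    have hrc' : r ≤ c := le_csSup hbdd hr
    rcases eq_or_lt_of_le hrc' with h | h
    · rw [← h]; exact hr.2
    · exact htrans _ _ _ hr.2 ((hnear r hr.1 (by rw [abs_lt]; constructor <;> linarith)).2 h)
  rcases eq_or_lt_of_le hcb with h | h
  · rwa [← h]
  · exfalso
    let r := min b (c + ε / 2)
    have hcr : c < r := lt_min h (by linarith)
    have hr : r ∈ Icc a b := ⟨hac.trans hcr.le, min_le_left _ _⟩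
    have hrε : r ≤ c + ε / 2 := min_le_right _ _
    have : r ∈ A := ⟨hr, htrans _ _ _ hRc
      ((hnear r hr (by rw [abs_lt]; constructor <;> linarith)).1 hcr)⟩
    exact (le_csSup hbdd this).not_gt hcr

end RealInduction

/-! ### Differentiability of pulled back metrics. -/

theorem differentiableAt_clm_of_apply {D E F : Type*} [NormedAddCommGroup D] [NormedSpace ℝ D]
    [NormedAddCommGroup E] [NormedSpace ℝ E] [FiniteDimensional ℝ E] [NormedAddCommGroup F]
    [NormedSpace ℝ F] {f : D → E →L[ℝ] F} {u : D}
    (h : ∀ a, DifferentiableAt ℝ (fun x => f x a) u) : DifferentiableAt ℝ f u := by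
  let b := Module.finBasis ℝ E
  let c : Fin (Module.finrank ℝ E) → E →L[ℝ] ℝ := fun i => LinearMap.toContinuousLinearMap (b.coord i)
  have hf : f = fun x => ∑ i, ContinuousLinearMap.smulRightL ℝ E F (c i) (f x (b i)) := by
    funext x
    ext a
    calc f x a = f x (∑ i, b.repr a i • b i) := by rw [b.sum_repr]
      _ = _ := by rw [map_sum]; simp [c]
  rw [hf]
  refine DifferentiableAt.fun_sum fun i _ => ?_
  exact (ContinuousLinearMap.smulRightL ℝ E F (c i)).differentiableAt.comp u (h (b i))

section MfderivSection

variable {E : Type*} [NormedAddCommGroup E] [NormedSpace ℝ E]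
  {M₀ : Type*} [TopologicalSpace M₀] [ChartedSpace E M₀] [IsManifold 𝓘(ℝ, E) ∞ M₀]
  {F : Type*} [NormedAddCommGroup F] [NormedSpace ℝ F]

theorem contMDiffAt_mfderiv_apply {f : F → M₀} {u : F} (hf : ContMDiffAt 𝓘(ℝ, F) 𝓘(ℝ, E) ∞ f u)
    (a : F) :
    ContMDiffAt 𝓘(ℝ, F) 𝓘(ℝ, E).tangent 1
      (fun x => (⟨f x, mfderiv 𝓘(ℝ, F) 𝓘(ℝ, E) f x a⟩ : TangentBundle 𝓘(ℝ, E) M₀)) u := by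
  have : IsManifold 𝓘(ℝ, E) 1 M₀ := IsManifold.of_le (n := ∞) (by simp)
  have h2 : ContMDiffAt 𝓘(ℝ, F) 𝓘(ℝ, E) 2 f u := mod_cast contMDiffAt_infty.1 hf 2
  have h3 := ContMDiffAt.mfderiv_const (m := 1) h2 (by norm_num)
  have h4 : ContMDiffAt 𝓘(ℝ, F) 𝓘(ℝ, F).tangent 1
      (fun x => (⟨x, a⟩ : TangentBundle 𝓘(ℝ, F) F)) u := by
    have : ContDiffAt ℝ 1 (fun _ : F => a) u := contDiffAt_const
    exact contMDiffAt_vectorSpace_iff_contDiffAt.2 this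
  exact ContMDiffAt.clm_apply_of_inCoordinates (b₁ := id) (b₂ := f) (E₁ := TangentSpace 𝓘(ℝ, F))
    (E₂ := TangentSpace 𝓘(ℝ, E)) h3 h4 (hf.of_le (by simp))

theorem differentiableAt_inner_apply
    (g₀ : Bundle.ContMDiffRiemannianMetric 𝓘(ℝ, E) ∞ E (fun x : M₀ => TangentSpace 𝓘(ℝ, E) x))
    {f : F → M₀} {u : F} (hf : ContMDiffAt 𝓘(ℝ, F) 𝓘(ℝ, E) ∞ f u)
    {v w : ∀ x : F, TangentSpace 𝓘(ℝ, E) (f x)}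
    (hv : ContMDiffAt 𝓘(ℝ, F) 𝓘(ℝ, E).tangent 1
      (fun x => (⟨f x, v x⟩ : TangentBundle 𝓘(ℝ, E) M₀)) u)
    (hw : ContMDiffAt 𝓘(ℝ, F) 𝓘(ℝ, E).tangent 1
      (fun x => (⟨f x, w x⟩ : TangentBundle 𝓘(ℝ, E) M₀)) u) :
    DifferentiableAt ℝ (fun x => g₀.inner (f x) (v x) (w x)) u := by
  have h : ContMDiffAt 𝓘(ℝ, F) (𝓘(ℝ, E).prod 𝓘(ℝ)) 1
      (fun x => Bundle.TotalSpace.mk' ℝ (E := Bundle.Trivial M₀ ℝ) (f x)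
        (g₀.inner (f x) (v x) (w x))) u := by
    apply ContMDiffAt.clm_bundle_apply₂ (F₁ := E) (F₂ := E)
    · exact (g₀.contMDiff.contMDiffAt.comp u hf).of_le (by simp)
    · exact hv
    · exact hw
  have h2 := (Bundle.contMDiffAt_totalSpace.1 h).2
  exact (h2.mdifferentiableAt (by simp)).differentiableAt

end MfderivSection

/-! ### The stationary metric as a Lorentzian metric. -/

namespace ConformallyStandardStationary

variable {E : Type*} [NormedAddCommGroup E] [NormedSpace ℝ E]
  {M₀ : Type*} [TopologicalSpace M₀] [ChartedSpace E M₀] [IsManifold 𝓘(ℝ, E) ∞ M₀]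
  (S : ConformallyStandardStationary E M₀)

/-- The scalar product of the Riemannian metric, on the model space. -/
def innerAt (x : M₀) : E →L[ℝ] E →L[ℝ] ℝ := S.g₀.inner x

/-- The vector field `δ` with values in the model space. -/
def shift (x : M₀) : E := S.δ x

theorem innerAt_symm (x : M₀) (v w : E) : S.innerAt x v w = S.innerAt x w v := S.g₀.symm x v w

theorem innerAt_pos (x : M₀) {v : E} (hv : v ≠ 0) : 0 < S.innerAt x v v := S.g₀.pos x v hv

theorem innerAt_nonneg (x : M₀) (v : E) : 0 ≤ S.innerAt x v v := by
  by_cases hv : v = 0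
  · simp [hv]
  · exact (S.innerAt_pos x hv).le

theorem formAt_metric (p : M₀ × ℝ) (v w : E × ℝ) :
    formAt S.metric p v w = S.φ p *
      (S.innerAt p.1 v.1 w.1 + S.innerAt p.1 (S.shift p.1) v.1 * w.2
        + S.innerAt p.1 (S.shift p.1) w.1 * v.2 - S.β p.1 * v.2 * w.2) :=
  S.metric_apply p.1 p.2 v.1 w.1 v.2 w.2

/-- The vector field `κ ∂_t`, which induces the given time orientation for `κ = 1` and the
opposite one for `κ = -1`. -/
def orientation (_S : ConformallyStandardStationary E M₀) (κ : ℝ) :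
    ∀ p : M₀ × ℝ, TangentSpace (𝓘(ℝ, E).prod 𝓘(ℝ, ℝ)) p :=
  fun _ => ((0, κ) : E × ℝ)

theorem orientation_neg (κ : ℝ) (p : M₀ × ℝ) :
    S.orientation (-κ) p = (-1 : ℝ) • S.orientation κ p := by
  change ((0, -κ) : E × ℝ) = (-1 : ℝ) • ((0, κ) : E × ℝ)
  simp

theorem isLorentzForm (p : M₀ × ℝ) {κ : ℝ} (hκ : κ ≠ 0) :
    IsLorentzForm (formAt S.metric p) ((0, κ) : E × ℝ) where
  symm v w := by
    rw [formAt_metric, formAt_metric, S.innerAt_symm p.1 v.1 w.1]; ring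
  neg := by
    rw [formAt_metric]
    simp only [map_zero, zero_mul, zero_add, zero_sub]
    have h1 := mul_pos (S.β_pos p.1) (mul_self_pos.2 hκ)
    exact mul_neg_of_pos_of_neg (S.φ_pos p) (by linarith)
  pos v hv hv0 := by
    rw [formAt_metric] at hv ⊢
    refine mul_pos (S.φ_pos p) ?_
    have h1 := (mul_eq_zero.1 hv).resolve_left (S.φ_pos p).ne'
    simp only [map_zero, zero_mul, add_zero, zero_add] at h1
    have h2 : S.innerAt p.1 (S.shift p.1) v.1 = S.β p.1 * v.2 := by
      have : κ * (S.innerAt p.1 (S.shift p.1) v.1 - S.β p.1 * v.2) = 0 := by linarith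
      linarith [(mul_eq_zero.1 this).resolve_left hκ]
    rw [h2]
    by_cases hy : v.1 = 0
    · have ht : v.2 ≠ 0 := fun h => hv0 (Prod.ext hy h)
      have := mul_pos (S.β_pos p.1) (mul_self_pos.2 ht)
      have := S.innerAt_nonneg p.1 v.1
      nlinarith
    · have := S.innerAt_pos p.1 hy
      have := mul_nonneg (S.β_pos p.1).le (mul_self_nonneg v.2)
      nlinarith

/-- The time component of a causal vector detects whether it is future-pointing. -/
theorem mul_snd_pos (p : M₀ × ℝ) {κ : ℝ} {v : E × ℝ} (hv : formAt S.metric p v v ≤ 0)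
    (hvY : formAt S.metric p v ((0, κ) : E × ℝ) < 0) : 0 < κ * v.2 := by
  have hφ := S.φ_pos p
  rw [formAt_metric] at hv hvY
  have h1 := le_of_mul_le_mul_left (hv.trans_eq (mul_zero _).symm) hφ
  have h2 := lt_of_mul_lt_mul_left (hvY.trans_eq (mul_zero _).symm) hφ.le
  simp only [map_zero, zero_mul, add_zero, zero_add] at h2
  set b := S.innerAt p.1 (S.shift p.1) v.1
  have hβ := S.β_pos p.1
  have hy := S.innerAt_nonneg p.1 v.1
  by_contra hc
  have hc' := not_lt.1 hc
  have hκ : κ ≠ 0 := by rintro rfl; simp at h2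
  have hκ2 : 0 < κ * κ := mul_self_pos.2 hκ
  -- If `κ * v.2 ≤ 0`, these inequalities force the spatial part of `v` to vanish, so `b = 0`,
  -- against `b * κ < 0`.
  have e1 : 0 ≤ (b * κ - S.β p.1 * v.2 * κ) * (κ * v.2) := mul_nonneg_of_nonpos_of_nonpos h2.le hc'
  have e2 : b * κ < 0 := by nlinarith
  have e3 : 0 ≤ (b * κ) * (κ * v.2) := mul_nonneg_of_nonpos_of_nonpos e2.le hc'
  have e4 : κ * κ * (S.innerAt p.1 v.1 v.1 + b * v.2 + b * v.2 - S.β p.1 * v.2 * v.2) ≤ 0 :=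
    mul_nonpos_of_nonneg_of_nonpos hκ2.le h1
  have e5 : κ * κ * S.innerAt p.1 v.1 v.1 ≤ 0 := by nlinarith
  have e6 : S.innerAt p.1 v.1 v.1 ≤ 0 := by
    by_contra h; exact (mul_pos hκ2 (not_le.1 h)).not_ge e5
  have hy0 : v.1 = 0 := by
    by_contra h; exact (S.innerAt_pos p.1 h).not_ge e6
  have hb0 : b = 0 := by simp [b, hy0]
  rw [hb0] at e2
  simp at e2

/-- Differentiability is tested on constant vectors `a`, `b`, where the pullback is an explicit
polynomial in `φ`, `β`, time derivatives and Riemannian products of `δ` and the spatial derivatives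
of `f`. -/
theorem isMetric [FiniteDimensional ℝ E] : IsMetric S.metric where
  symm p := (S.isLorentzForm p one_ne_zero).symm
  nondegenerate p _ := (S.isLorentzForm p one_ne_zero).eq_zero_of_forall
  smooth f u hf := by
    refine differentiableAt_clm_of_apply fun a => differentiableAt_clm_of_apply fun b => ?_
    have hf1 : ContMDiffAt 𝓘(ℝ, E × ℝ) 𝓘(ℝ, E) ∞ (fun x => (f x).1) u := hf.fst
    have hf2 : ContMDiffAt 𝓘(ℝ, E × ℝ) 𝓘(ℝ, ℝ) ∞ (fun x => (f x).2) u := hf.snd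
    have hev : ∀ᶠ x in 𝓝 u, MDifferentiableAt 𝓘(ℝ, E × ℝ) (𝓘(ℝ, E).prod 𝓘(ℝ, ℝ)) f x := by
      have h1 : ContMDiffAt 𝓘(ℝ, E × ℝ) (𝓘(ℝ, E).prod 𝓘(ℝ, ℝ)) 1 f u := hf.of_le (by simp)
      obtain ⟨t, ht, h⟩ := (contMDiffAt_iff_contMDiffOn_nhds (by simp)).1 h1
      filter_upwards [eventually_mem_nhds_iff.2 ht] with x hx
      exact (h.contMDiffAt hx).mdifferentiableAt (by simp)
    let D : (E × ℝ) → (x : E × ℝ) → TangentSpace 𝓘(ℝ, E) (f x).1 := fun c x =>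
      mfderiv 𝓘(ℝ, E × ℝ) 𝓘(ℝ, E) (fun x => (f x).1) x c
    have hD : ∀ c, ContMDiffAt 𝓘(ℝ, E × ℝ) 𝓘(ℝ, E).tangent 1
        (fun x => (⟨(f x).1, D c x⟩ : TangentBundle 𝓘(ℝ, E) M₀)) u :=
      fun c => contMDiffAt_mfderiv_apply hf1 c
    have hδ : ContMDiffAt 𝓘(ℝ, E × ℝ) 𝓘(ℝ, E).tangent 1
        (fun x => (⟨(f x).1, S.δ (f x).1⟩ : TangentBundle 𝓘(ℝ, E) M₀)) u :=
      (S.δ_smooth.contMDiffAt.comp u hf1).of_le (by simp)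
    have hφ : DifferentiableAt ℝ (fun x => S.φ (f x)) u :=
      ((S.φ_smooth.contMDiffAt.comp u hf).mdifferentiableAt (by simp)).differentiableAt
    have hβ : DifferentiableAt ℝ (fun x => S.β (f x).1) u :=
      ((S.β_smooth.contMDiffAt.comp u hf1).mdifferentiableAt (by simp)).differentiableAt
    have hT : ∀ c, DifferentiableAt ℝ (fun x => fderiv ℝ (fun x => (f x).2) x c) u := fun c => by
      have h2 : ContDiffAt ℝ 2 (fun x => (f x).2) u := mod_cast contDiffAt_infty.1 hf2.contDiffAt 2
      exact ((h2.fderiv_right (m := 1) (by norm_num)).differentiableAt (by norm_num)).clm_apply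
        (differentiableAt_const c)
    have hmain := hφ.mul ((((differentiableAt_inner_apply S.g₀ hf1 (hD a) (hD b)).add
      ((differentiableAt_inner_apply S.g₀ hf1 hδ (hD a)).mul (hT b))).add
      ((differentiableAt_inner_apply S.g₀ hf1 hδ (hD b)).mul (hT a))).sub
      ((hβ.mul (hT a)).mul (hT b)))
    refine hmain.congr_of_eventuallyEq ?_
    filter_upwards [hev] with x hx
    have h1 : ∀ c, (modelDeriv (𝓘(ℝ, E).prod 𝓘(ℝ, ℝ)) f x c).1 = D c x := fun c => by
      have := ((hasMFDerivAt_fst (f x)).comp x hx.hasMFDerivAt).mfderiv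
      exact (congrArg (fun L : E × ℝ →L[ℝ] E => L c) this).symm
    have h2 : ∀ c, (modelDeriv (𝓘(ℝ, E).prod 𝓘(ℝ, ℝ)) f x c).2
        = fderiv ℝ (fun x => (f x).2) x c := fun c => by
      have := ((hasMFDerivAt_snd (f x)).comp x hx.hasMFDerivAt).mfderiv
      rw [mfderiv_eq_fderiv] at this
      exact (congrArg (fun L : E × ℝ →L[ℝ] ℝ => L c) this).symm
    rw [pullback_apply, formAt_metric, h1, h1, h2, h2]
    rfl

end ConformallyStandardStationary

/-! ### Velocities in normal charts and the continuity argument for cones. -/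

section Velocity

variable {E : Type*} [NormedAddCommGroup E] [NormedSpace ℝ E]
  {H : Type*} [TopologicalSpace H] {M : Type*} [TopologicalSpace M] [ChartedSpace H M]

/-- The velocity of a curve, as a vector of the model space. -/
def modelVelocity (I : ModelWithCorners ℝ E H) (γ : ℝ → M) (J : Set ℝ) (s : ℝ) : E :=
  velocity I γ J s

end Velocity

namespace IsNormalChart

variable {E : Type*} [NormedAddCommGroup E] [NormedSpace ℝ E]
  {H : Type*} [TopologicalSpace H] {I : ModelWithCorners ℝ E H}
  {M : Type*} [TopologicalSpace M] [ChartedSpace H M]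
  {g : BilinField I M} {e : OpenPartialHomeomorph E M} {x : M}

/-- The Gauss lemma along a ray. -/
theorem gauss_ray [FiniteDimensional ℝ E] [I.Boundaryless] [IsManifold I ∞ M]
    (hg : IsMetric g) (h : IsNormalChart g e x) {v : E} (hv : v ∈ e.source) {t : ℝ}
    (ht : t ∈ Icc (0 : ℝ) 1) (w : E) :
    formAt g (e (t • v)) (modelDeriv I e (t • v) v) (modelDeriv I e (t • v) w)
      = formAt g x v w := by
  rcases eq_or_ne t 0 with rfl | ht0
  · rw [zero_smul, h.mfderiv_zero, h.map_zero]; rfl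
  · have := h.gauss hg (h.smul_mem hv ht) w
    simp only [map_smul, smul_apply, smul_eq_mul] at this
    exact mul_left_cancel₀ ht0 this

theorem modelVelocity_ray (h : IsNormalChart g e x) {v : E} (hv : v ∈ e.source) {t : ℝ}
    (ht : t ∈ Icc (0 : ℝ) 1) :
    modelVelocity I (fun s : ℝ => e (s • v)) (Icc 0 1) t = modelDeriv I e (t • v) v :=
  h.velocity_ray hv ht

theorem symm_self (h : IsNormalChart g e x) : e.symm x = 0 := by
  rw [← h.map_zero, e.left_inv h.zero_mem]

theorem contDiffOn_symm_comp (h : IsNormalChart g e x) {σ : ℝ → M} {c d : ℝ}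
    (hσ : ContMDiffOn 𝓘(ℝ, ℝ) I ∞ σ (Icc c d)) (hU : MapsTo σ (Icc c d) e.target) :
    ContDiffOn ℝ ∞ (fun s => e.symm (σ s)) (Icc c d) :=
  (h.smooth_symm.comp hσ hU).contDiffOn

theorem modelDeriv_derivWithin (h : IsNormalChart g e x) {σ : ℝ → M} {c d : ℝ} (hcd : c < d)
    (hσ : ContMDiffOn 𝓘(ℝ, ℝ) I ∞ σ (Icc c d)) (hU : MapsTo σ (Icc c d) e.target)
    {s : ℝ} (hs : s ∈ Icc c d) :
    modelDeriv I e (e.symm (σ s)) (derivWithin (fun s => e.symm (σ s)) (Icc c d) s)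
      = modelVelocity I σ (Icc c d) s := by
  have h1 := ((h.contDiffOn_symm_comp hσ hU).differentiableOn (by simp) s hs).hasDerivWithinAt
  have h2 := (h.mdifferentiableAt (e.map_target (hU hs))).hasMFDerivAt.comp_hasMFDerivWithinAt s
    h1.hasFDerivWithinAt.hasMFDerivWithinAt
  have hud : UniqueMDiffWithinAt 𝓘(ℝ, ℝ) (Icc c d) s :=
    (uniqueDiffOn_Icc hcd s hs).uniqueMDiffWithinAt
  have h3 : modelVelocity I (fun s => e (e.symm (σ s))) (Icc c d) s =
      modelDeriv I e (e.symm (σ s)) (derivWithin (fun s => e.symm (σ s)) (Icc c d) s) := by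
    have := congrArg (fun f : ℝ →L[ℝ] E => f 1) (h2.mfderivWithin hud)
    refine this.trans ?_
    change modelDeriv I e (e.symm (σ s)) ((ContinuousLinearMap.toSpanSingleton ℝ
      (derivWithin (fun s => e.symm (σ s)) (Icc c d) s)) (1 : ℝ)) = _
    simp
  rw [← h3]
  exact velocity_congr (fun r hr => e.right_inv (hU hr)) hs

end IsNormalChart

/-- The continuity argument for the cone lemma: a curve in the tangent space which enters the open
cone and along which the quadratic form decreases inside the cone, remains in the cone. -/
theorem mem_cone_of_deriv {V : Type*} [NormedAddCommGroup V] [NormedSpace ℝ V]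
    {B : V →L[ℝ] V →L[ℝ] ℝ} {Y : V} (hB : IsLorentzForm B Y) {f f' : ℝ → V} {c d : ℝ} (hcd : c < d)
    (hf : ∀ s ∈ Icc c d, HasDerivWithinAt f (f' s) (Icc c d) s) (hfc : f c = 0)
    (hc : B (f' c) (f' c) < 0) (hcY : B (f' c) Y < 0)
    (hdec : ∀ s ∈ Icc c d, B (f s) (f s) < 0 → B (f s) Y < 0 → B (f s) (f' s) < 0) :
    B (f d) (f d) < 0 ∧ B (f d) Y < 0 := by
  let K : Set V := {v | B v v < 0 ∧ B v Y < 0}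
  have hq : Continuous fun v => B v v := by fun_prop
  have hl : Continuous fun v => B v Y := by fun_prop
  have hK : IsOpen K := (isOpen_lt hq continuous_const).inter (isOpen_lt hl continuous_const)
  have hcont : ContinuousOn f (Icc c d) := fun s hs => (hf s hs).continuousWithinAt
  -- `f c = 0` is the vertex, not a point of the open cone; the slopes of `f` at `c` tend to `f' c`
  -- in the cone, which is stable under positive scaling.
  have hstart : ∃ c' > c, ∀ s ∈ Ioc c d, s < c' → f s ∈ K := by
    have h1 := hasDerivWithinAt_iff_tendsto_slope.1 (hf c ⟨le_rfl, hcd.le⟩)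
    have h2 : ∀ᶠ s in 𝓝[Icc c d \ {c}] c, slope f c s ∈ K :=
      h1.eventually (hK.mem_nhds ⟨hc, hcY⟩)
    obtain ⟨u, hu, hu'⟩ := mem_nhdsWithin_iff_exists_mem_nhds_inter.1 h2
    obtain ⟨ε, hε, hball⟩ := Metric.mem_nhds_iff.1 hu
    refine ⟨c + ε, by linarith, fun s hs hsc => ?_⟩
    have h3 : slope f c s ∈ K := hu' ⟨hball (by
      rw [Metric.mem_ball, Real.dist_eq, abs_lt]; constructor <;> linarith [hs.1]),
      ⟨hs.1.le, hs.2⟩, ne_of_gt hs.1⟩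
    have h4 : f s = (s - c) • slope f c s := by simp [sub_smul_slope, hfc]
    have h5 : 0 < s - c := sub_pos.2 hs.1
    rw [h4]
    simp only [K, mem_ofPred_eq, map_smul, smul_apply, smul_eq_mul]
    exact ⟨mul_neg_of_pos_of_neg h5 (mul_neg_of_pos_of_neg h5 h3.1),
      mul_neg_of_pos_of_neg h5 h3.2⟩
  obtain ⟨c', hc', hgood⟩ := hstart
  by_contra hbad
  let A : Set ℝ := {s ∈ Ioc c d | f s ∉ K}
  have hdA : d ∈ A := ⟨⟨hcd, le_rfl⟩, hbad⟩
  have hbdd : BddBelow A := ⟨c, fun s hs => hs.1.1.le⟩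
  set m := sInf A with hm
  have hc'm : c' ≤ m := le_csInf ⟨d, hdA⟩ fun s hs => by
    by_contra h; exact hs.2 (hgood s hs.1 (not_le.1 h))
  have hmd : m ≤ d := csInf_le hbdd hdA
  have hcm : c < m := lt_of_lt_of_le hc' hc'm
  have hmI : m ∈ Icc c d := ⟨hcm.le, hmd⟩
  have hbefore : ∀ s ∈ Ioo c m, f s ∈ K := fun s hs => by
    by_contra h
    exact (csInf_le hbdd (show s ∈ A from ⟨⟨hs.1, hs.2.le.trans hmd⟩, h⟩)).not_gt hs.2
  have hmK : f m ∉ K := by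
    intro h
    have h1 : ∀ᶠ s in 𝓝[Icc c d] m, f s ∈ K := (hcont m hmI).eventually (hK.mem_nhds h)
    obtain ⟨u, hu, hu'⟩ := mem_nhdsWithin_iff_exists_mem_nhds_inter.1 h1
    obtain ⟨ε, hε, hball⟩ := Metric.mem_nhds_iff.1 hu
    obtain ⟨s, hs, hsm⟩ := exists_lt_of_csInf_lt ⟨d, hdA⟩ (lt_add_of_pos_right m hε)
    have hms : m ≤ s := csInf_le hbdd hs
    exact hs.2 (hu' ⟨hball (by rw [Metric.mem_ball, Real.dist_eq, abs_lt]; constructor <;> linarith),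
      ⟨hs.1.1.le, hs.1.2⟩⟩)
  obtain ⟨a, hca, ham⟩ := exists_between hcm
  have hsub : Icc a m ⊆ Icc c d := Icc_subset_Icc hca.le hmd
  -- At the first exit parameter `m` the form is still negative because it has decreased, and then
  -- `B (f m) Y`, nonpositive as a limit, cannot vanish; so `f m` is in the cone after all.
  have hanti : StrictAntiOn (fun s => B (f s) (f s)) (Icc a m) := by
    refine strictAntiOn_of_hasDerivWithinAt_neg (f' := fun s => 2 * B (f s) (f' s))
      (convex_Icc a m) (hq.comp_continuousOn (hcont.mono hsub)) ?_ ?_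
    · intro s hs
      rw [interior_Icc] at hs ⊢
      have h1 := (hf s (hsub (Ioo_subset_Icc_self hs))).mono (Ioo_subset_Icc_self.trans hsub)
      have h2 : HasDerivWithinAt (fun s => B (f s)) (B (f' s)) (Ioo a m) s :=
        B.hasFDerivAt.comp_hasDerivWithinAt s h1
      refine (h2.clm_apply h1).congr_deriv ?_
      rw [hB.symm (f' s) (f s)]; ring
    · intro s hs
      rw [interior_Icc] at hs
      have h1 := hbefore s ⟨hca.trans hs.1, hs.2⟩
      have := hdec s (hsub (Ioo_subset_Icc_self hs)) h1.1 h1.2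
      linarith
  have hqm : B (f m) (f m) < 0 :=
    (hanti ⟨le_rfl, ham.le⟩ ⟨ham.le, le_rfl⟩ ham).trans (hbefore a ⟨hca, ham⟩).1
  have hlm : B (f m) Y ≤ 0 := by
    have h1 : Filter.Tendsto (fun s => B (f s) Y) (𝓝[Ioo c m] m) (𝓝 (B (f m) Y)) :=
      (hl.continuousAt.comp_continuousWithinAt ((hcont m hmI).mono
        (Ioo_subset_Icc_self.trans (Icc_subset_Icc_right hmd))))
    have : (𝓝[Ioo c m] m).NeBot := by
      rw [nhdsWithin_Ioo_eq_nhdsLT hcm]; infer_instance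
    exact le_of_tendsto h1 (by filter_upwards [self_mem_nhdsWithin] with s hs using (hbefore s hs).2.le)
  exact hmK ⟨hqm, lt_of_le_of_ne hlm
    (hB.apply_ne_zero hqm.le (IsLorentzForm.ne_zero_of_neg hqm))⟩

/-! ### Causal curves in normal charts: the cone lemma. -/

namespace ConformallyStandardStationary

variable {E : Type*} [NormedAddCommGroup E] [NormedSpace ℝ E]
  {M₀ : Type*} [TopologicalSpace M₀] [ChartedSpace E M₀] [IsManifold 𝓘(ℝ, E) ∞ M₀]
  {S : ConformallyStandardStationary E M₀} {κ : ℝ}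

theorem hasDerivWithinAt_time {σ : ℝ → M₀ × ℝ} {J : Set ℝ} {s : ℝ}
    (hσ : MDifferentiableWithinAt 𝓘(ℝ, ℝ) (𝓘(ℝ, E).prod 𝓘(ℝ, ℝ)) σ J s) :
    HasDerivWithinAt (fun r => (σ r).2)
      (modelVelocity (𝓘(ℝ, E).prod 𝓘(ℝ, ℝ)) σ J s).2 J s := by
  have h := (hasMFDerivAt_snd (I := 𝓘(ℝ, E)) (I' := 𝓘(ℝ, ℝ)) (σ s)).comp_hasMFDerivWithinAt s
    hσ.hasMFDerivWithinAt
  have h' : HasFDerivWithinAt (fun r => (σ r).2) ((ContinuousLinearMap.snd ℝ E ℝ).comp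
      (mfderivWithin 𝓘(ℝ, ℝ) (𝓘(ℝ, E).prod 𝓘(ℝ, ℝ)) σ J s : ℝ →L[ℝ] E × ℝ)) J s :=
    h.hasFDerivWithinAt
  exact h'.hasDerivWithinAt

/-- The dependence on `t` is only through the positive factor `φ`, which does not affect signs. -/
theorem formAt_nonpos_translate {x : M₀} {t t' : ℝ} {v w : E × ℝ}
    (h : formAt S.metric (x, t) v w ≤ 0) : formAt S.metric (x, t') v w ≤ 0 := by
  rw [formAt_metric] at h ⊢
  exact mul_nonpos_of_nonneg_of_nonpos (S.φ_pos _).le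
    (le_of_mul_le_mul_left (h.trans_eq (mul_zero _).symm) (S.φ_pos _))

theorem formAt_neg_translate {x : M₀} {t t' : ℝ} {v w : E × ℝ}
    (h : formAt S.metric (x, t) v w < 0) : formAt S.metric (x, t') v w < 0 := by
  rw [formAt_metric] at h ⊢
  exact mul_neg_of_pos_of_neg (S.φ_pos _)
    (lt_of_mul_lt_mul_left (h.trans_eq (mul_zero _).symm) (S.φ_pos _).le)

/-- The coordinate `κ t` strictly increases along causal curves. -/
theorem time_lt {σ : ℝ → M₀ × ℝ} {c d : ℝ}
    (h : IsSmoothCausalCurve S.metric (S.orientation κ) σ c d) :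
    κ * (σ c).2 < κ * (σ d).2 := by
  have hd : ∀ s ∈ Icc c d, HasDerivWithinAt (fun r => κ * (σ r).2)
      (κ * (modelVelocity (𝓘(ℝ, E).prod 𝓘(ℝ, ℝ)) σ (Icc c d) s).2) (Icc c d) s := fun s hs =>
    (hasDerivWithinAt_time ((h.smooth s hs).mdifferentiableWithinAt (by simp))).const_mul κ
  have hmono : StrictMonoOn (fun r => κ * (σ r).2) (Icc c d) := by
    refine strictMonoOn_of_hasDerivWithinAt_pos (convex_Icc c d)
      (fun s hs => (hd s hs).continuousWithinAt)
      (fun s hs => (hd s (interior_subset hs)).mono interior_subset) fun s hs => ?_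
    exact S.mul_snd_pos (σ s) (h.nonSpacelike s (interior_subset hs)).2
      (h.future s (interior_subset hs))
  exact hmono ⟨le_rfl, h.lt.le⟩ ⟨h.lt.le, le_rfl⟩ h.lt

variable [FiniteDimensional ℝ E] {e : OpenPartialHomeomorph (E × ℝ) (M₀ × ℝ)} {x : M₀ × ℝ}

/-- Radial geodesics with causal future-pointing initial velocity keep this character. -/
theorem ray_causal (hκ : κ ≠ 0) (h : IsNormalChart S.metric e x) {v : E × ℝ} (hv : v ∈ e.source)
    (hvv : formAt S.metric x v v ≤ 0) (hvY : formAt S.metric x v ((0, κ) : E × ℝ) < 0)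
    {t : ℝ} (ht : t ∈ Icc (0 : ℝ) 1) :
    modelDeriv (𝓘(ℝ, E).prod 𝓘(ℝ, ℝ)) e (t • v) v ≠ 0 ∧
    formAt S.metric (e (t • v)) (modelDeriv (𝓘(ℝ, E).prod 𝓘(ℝ, ℝ)) e (t • v) v)
      (modelDeriv (𝓘(ℝ, E).prod 𝓘(ℝ, ℝ)) e (t • v) v) = formAt S.metric x v v ∧
    formAt S.metric (e (t • v)) (modelDeriv (𝓘(ℝ, E).prod 𝓘(ℝ, ℝ)) e (t • v) v)
      ((0, κ) : E × ℝ) < 0 := by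
  let P : ℝ → E × ℝ := fun t => modelDeriv (𝓘(ℝ, E).prod 𝓘(ℝ, ℝ)) e (t • v) v
  have hv0 : v ≠ 0 := by rintro rfl; simp at hvY
  have hPP : ∀ t ∈ Icc (0 : ℝ) 1, formAt S.metric (e (t • v)) (P t) (P t) = formAt S.metric x v v :=
    fun t ht => h.gauss_ray S.isMetric hv ht v
  -- By the Gauss lemma, a vanishing velocity would make `v` orthogonal to every vector.
  have hP0 : ∀ t ∈ Icc (0 : ℝ) 1, P t ≠ 0 := by
    intro t ht h0
    refine hv0 ((S.isLorentzForm x hκ).eq_zero_of_forall fun w => ?_)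
    have h1 : modelDeriv (𝓘(ℝ, E).prod 𝓘(ℝ, ℝ)) e (t • v) v = 0 := h0
    rw [← h.gauss_ray S.isMetric hv ht w, h1]
    simp
  have hPY : ∀ t ∈ Icc (0 : ℝ) 1, formAt S.metric (e (t • v)) (P t) ((0, κ) : E × ℝ) ≠ 0 :=
    fun t ht => (S.isLorentzForm _ hκ).apply_ne_zero ((hPP t ht).trans_le hvv) (hP0 t ht)
  have hneg : ∀ t ∈ Icc (0 : ℝ) 1, ¬ formAt S.metric (e (t • v)) (P t) ((0, κ) : E × ℝ) < 0 →
      κ * (P t).2 < 0 := by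
    intro t ht hn
    have h1 : 0 < formAt S.metric (e (t • v)) (P t) ((0, κ) : E × ℝ) :=
      lt_of_le_of_ne (not_lt.1 hn) (hPY t ht).symm
    have h2 := S.mul_snd_pos (e (t • v)) (κ := κ) (v := -P t)
      (by simpa using (hPP t ht).trans_le hvv) (by simpa using h1)
    simp only [Prod.snd_neg, mul_neg] at h2
    linarith
  have hpos : ∀ t ∈ Icc (0 : ℝ) 1, formAt S.metric (e (t • v)) (P t) ((0, κ) : E × ℝ) < 0 →
      0 < κ * (P t).2 := fun t ht hn => S.mul_snd_pos _ ((hPP t ht).trans_le hvv) hn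
  have hsm := (h.geodesic v hv).smooth
  have hder : ∀ t ∈ Icc (0 : ℝ) 1,
      (P t).2 = derivWithin (fun r : ℝ => (e (r • v)).2) (Icc 0 1) t := by
    intro t ht
    have h1 := hasDerivWithinAt_time ((hsm t ht).mdifferentiableWithinAt (by simp))
    rw [h1.derivWithin (uniqueDiffOn_Icc zero_lt_one t ht), h.modelVelocity_ray hv ht]
  -- The sign of `κ * (P t).2` tells future from past and is never zero; being continuous, it cannot
  -- change along the ray.
  have hcont : ContinuousOn (fun t => κ * (P t).2) (Icc 0 1) := by
    have h1 : ContDiffOn ℝ ∞ (fun r : ℝ => (e (r • v)).2) (Icc 0 1) := (contMDiff_snd.comp_contMDiffOn hsm).contDiffOn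
    have h2 := h1.continuousOn_derivWithin (uniqueDiffOn_Icc zero_lt_one) (by simp)
    exact (h2.congr hder).const_smul κ
  refine ⟨hP0 t ht, hPP t ht, ?_⟩
  by_contra hn
  have h0 : (0 : ℝ) ∈ Icc (0 : ℝ) 1 := ⟨le_rfl, zero_le_one⟩
  have hstart : 0 < κ * (P 0).2 := by
    refine hpos 0 h0 ?_
    have h1 : P 0 = v := by simp [P, h.mfderiv_zero]
    rw [h1, zero_smul, h.map_zero]
    exact hvY
  obtain ⟨r, hr, hr0⟩ := intermediate_value_Icc' ht.1 (hcont.mono (Icc_subset_Icc_right ht.2))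
    ⟨(hneg t ht hn).le, hstart.le⟩
  have hr' : r ∈ Icc (0 : ℝ) 1 := ⟨hr.1, hr.2.trans ht.2⟩
  by_cases h1 : formAt S.metric (e (r • v)) (P r) ((0, κ) : E × ℝ) < 0
  · exact (hpos r hr' h1).ne' hr0
  · exact (hneg r hr' h1).ne hr0

theorem ray_isSmoothCausalCurve (hκ : κ ≠ 0) (h : IsNormalChart S.metric e x) {v : E × ℝ}
    (hv : v ∈ e.source) (hvv : formAt S.metric x v v ≤ 0)
    (hvY : formAt S.metric x v ((0, κ) : E × ℝ) < 0) :
    IsSmoothCausalCurve S.metric (S.orientation κ) (fun s : ℝ => e (s • v)) 0 1 := by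
  refine ⟨zero_lt_one, (h.geodesic v hv).smooth, fun s hs => ?_, fun s hs => ?_⟩
  · have h1 := ray_causal hκ h hv hvv hvY hs
    change IsNonSpacelike S.metric (e (s • v)) (modelVelocity _ _ _ _ : E × ℝ)
    rw [h.modelVelocity_ray hv hs]
    exact ⟨h1.1, h1.2.1.trans_le hvv⟩
  · have h1 := ray_causal hκ h hv hvv hvY hs
    change IsFuturePointing S.metric _ (e (s • v)) (modelVelocity _ _ _ _ : E × ℝ)
    rw [h.modelVelocity_ray hv hs]
    exact h1.2.2

theorem ray_isLightlikeGeodesic (hκ : κ ≠ 0) (h : IsNormalChart S.metric e x) {v : E × ℝ}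
    (hv : v ∈ e.source) (hvv : formAt S.metric x v v = 0)
    (hvY : formAt S.metric x v ((0, κ) : E × ℝ) < 0) :
    IsLightlikeGeodesic S.metric (S.orientation κ) (fun s : ℝ => e (s • v)) 0 1 := by
  refine ⟨zero_lt_one, h.geodesic v hv, fun s hs => ?_, fun s hs => ?_⟩
  · have h1 := ray_causal hκ h hv hvv.le hvY hs
    change IsLightlike S.metric (e (s • v)) (modelVelocity _ _ _ _ : E × ℝ)
    rw [h.modelVelocity_ray hv hs]
    exact ⟨h1.1, h1.2.1.trans hvv⟩
  · have h1 := ray_causal hκ h hv hvv.le hvY hs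
    change IsFuturePointing S.metric _ (e (s • v)) (modelVelocity _ _ _ _ : E × ℝ)
    rw [h.modelVelocity_ray hv hs]
    exact h1.2.2

/-- A timelike curve starting at the centre of a normal chart stays in the timelike cone. -/
theorem mem_cone_of_timelike (hκ : κ ≠ 0) (h : IsNormalChart S.metric e x) {σ : ℝ → M₀ × ℝ}
    {c d : ℝ} (hσ : IsSmoothCausalCurve S.metric (S.orientation κ) σ c d)
    (htime : ∀ s ∈ Icc c d, formAt S.metric (σ s)
      (modelVelocity (𝓘(ℝ, E).prod 𝓘(ℝ, ℝ)) σ (Icc c d) s)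
      (modelVelocity (𝓘(ℝ, E).prod 𝓘(ℝ, ℝ)) σ (Icc c d) s) < 0)
    (hx : σ c = x) (hU : MapsTo σ (Icc c d) e.target) :
    formAt S.metric x (e.symm (σ d)) (e.symm (σ d)) < 0 ∧
      formAt S.metric x (e.symm (σ d)) ((0, κ) : E × ℝ) < 0 := by
  set f : ℝ → E × ℝ := fun s => e.symm (σ s) with hf
  set f' : ℝ → E × ℝ := derivWithin f (Icc c d) with hf'
  have hd : ∀ s ∈ Icc c d, HasDerivWithinAt f (f' s) (Icc c d) s :=
    fun s hs => ((h.contDiffOn_symm_comp hσ.smooth hU).differentiableOn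
      (by simp) s hs).hasDerivWithinAt
  have hvel : ∀ s ∈ Icc c d, modelDeriv (𝓘(ℝ, E).prod 𝓘(ℝ, ℝ)) e (f s) (f' s)
      = modelVelocity (𝓘(ℝ, E).prod 𝓘(ℝ, ℝ)) σ (Icc c d) s :=
    fun s hs => h.modelDeriv_derivWithin hσ.lt hσ.smooth hU hs
  have hfut : ∀ s ∈ Icc c d, formAt S.metric (σ s)
      (modelVelocity (𝓘(ℝ, E).prod 𝓘(ℝ, ℝ)) σ (Icc c d) s) ((0, κ) : E × ℝ) < 0 :=
    fun s hs => hσ.future s hs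
  have hlt := hσ.lt
  clear hσ
  have hc : c ∈ Icc c d := ⟨le_rfl, hlt.le⟩
  have hfc : f c = 0 := by rw [hf]; simp only [hx]; exact h.symm_self
  have hv0 : f' c = modelVelocity (𝓘(ℝ, E).prod 𝓘(ℝ, ℝ)) σ (Icc c d) c := by
    have := hvel c hc
    rwa [hfc, h.mfderiv_zero] at this
  have hc1 : formAt S.metric x (f' c) (f' c) < 0 := by
    rw [hv0, ← hx]; exact htime c hc
  have hc2 : formAt S.metric x (f' c) ((0, κ) : E × ℝ) < 0 := by
    rw [hv0, ← hx]; exact hfut c hc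
  -- By the Gauss lemma this is the product of the radial velocity with that of `σ`, both timelike
  -- and future-pointing.
  have hdec : ∀ s ∈ Icc c d, formAt S.metric x (f s) (f s) < 0 →
      formAt S.metric x (f s) ((0, κ) : E × ℝ) < 0 → formAt S.metric x (f s) (f' s) < 0 := by
    intro s hs h1 h2
    have hs' : f s ∈ e.source := e.map_target (hU hs)
    have h3 := ray_causal hκ h hs' h1.le h2 ⟨zero_le_one, le_rfl⟩
    have h4 := h.gauss S.isMetric hs' (f' s)
    rw [one_smul] at h3
    rw [← h4, hvel s hs]
    have h5 : e (f s) = σ s := e.right_inv (hU hs)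
    rw [h5] at h3 ⊢
    exact (S.isLorentzForm (σ s) hκ).apply_neg (h3.2.1.trans_lt h1) h3.2.2
      (htime s hs).le (hfut s hs)
  have key := mem_cone_of_deriv (V := E × ℝ) (B := formAt S.metric x) (Y := ((0, κ) : E × ℝ))
    (f := f) (f' := f') (S.isLorentzForm x hκ) hlt hd hfc hc1 hc2 hdec
  exact key

/-- Tilting a causal curve towards the direction of time makes it timelike. -/
theorem tilt_isSmoothCausalCurve (hκ : κ ≠ 0) {σ : ℝ → M₀ × ℝ} {c d : ℝ}
    (hσ : IsSmoothCausalCurve S.metric (S.orientation κ) σ c d) {ε : ℝ} (hε : 0 < ε) :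
    IsSmoothCausalCurve S.metric (S.orientation κ)
      (fun s => ((σ s).1, (σ s).2 + ε * κ * (s - c))) c d ∧
    ∀ s ∈ Icc c d, formAt S.metric ((σ s).1, (σ s).2 + ε * κ * (s - c))
      (modelVelocity (𝓘(ℝ, E).prod 𝓘(ℝ, ℝ)) (fun s => ((σ s).1, (σ s).2 + ε * κ * (s - c))) (Icc c d) s)
      (modelVelocity (𝓘(ℝ, E).prod 𝓘(ℝ, ℝ)) (fun s => ((σ s).1, (σ s).2 + ε * κ * (s - c))) (Icc c d) s) < 0 := by
  set ρ : ℝ → M₀ × ℝ := fun s => ((σ s).1, (σ s).2 + ε * κ * (s - c)) with hρ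
  have hlin : ContMDiff 𝓘(ℝ, ℝ) 𝓘(ℝ, ℝ) ∞ fun s : ℝ => ε * κ * (s - c) := by
    have : ContDiff ℝ ∞ fun s : ℝ => ε * κ * (s - c) := by fun_prop
    exact this.contMDiff
  have hsm : ContMDiffOn 𝓘(ℝ, ℝ) (𝓘(ℝ, E).prod 𝓘(ℝ, ℝ)) ∞ ρ (Icc c d) :=
    (contMDiff_fst.comp_contMDiffOn hσ.smooth).prodMk
      ((contMDiff_snd.comp_contMDiffOn hσ.smooth).add hlin.contMDiffOn)
  let V : (ℝ → M₀ × ℝ) → ℝ → E × ℝ := fun τ s =>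
    modelVelocity (𝓘(ℝ, E).prod 𝓘(ℝ, ℝ)) τ (Icc c d) s
  have hvel : ∀ s ∈ Icc c d, (V ρ s)
      = (V σ s) + ε • ((0, κ) : E × ℝ) := by
    intro s hs
    have hud : UniqueMDiffWithinAt 𝓘(ℝ, ℝ) (Icc c d) s :=
      (uniqueDiffOn_Icc hσ.lt s hs).uniqueMDiffWithinAt
    have hσd := (hσ.smooth s hs).mdifferentiableWithinAt (by simp)
    have h1 := (hasMFDerivAt_fst (I := 𝓘(ℝ, E)) (I' := 𝓘(ℝ, ℝ)) (σ s)).comp_hasMFDerivWithinAt s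
      hσd.hasMFDerivWithinAt
    have h2 : HasDerivWithinAt (fun s => (σ s).2 + ε * κ * (s - c))
        ((V σ s).2 + ε * κ) (Icc c d) s := by
      have h3 : HasDerivAt (fun s : ℝ => ε * κ * (s - c)) (ε * κ) s := by
        simpa using ((hasDerivAt_id s).sub_const c).const_mul (ε * κ)
      exact (hasDerivWithinAt_time hσd).add h3.hasDerivWithinAt
    have h4 := (h1.prodMk h2.hasFDerivWithinAt.hasMFDerivWithinAt).mfderivWithin hud
    have h5 := congrArg (fun f : ℝ →L[ℝ] E × ℝ => f 1) h4
    refine h5.trans ?_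
    refine Prod.ext ?_ ?_
    · change (V σ s).1 = _
      simp
    · change (ContinuousLinearMap.toSpanSingleton ℝ
        ((V σ s).2 + ε * κ)) (1 : ℝ) = _
      simp
  have hneg : ∀ s ∈ Icc c d,
      formAt S.metric (ρ s) (V ρ s)
        (V ρ s) < 0 ∧
      formAt S.metric (ρ s) (V ρ s)
        ((0, κ) : E × ℝ) < 0 := by
    intro s hs
    rw [hvel s hs]
    exact (S.isLorentzForm (ρ s) hκ).add_smul_neg
      (formAt_nonpos_translate (t := (σ s).2) (hσ.nonSpacelike s hs).2)
      (formAt_neg_translate (t := (σ s).2) (hσ.future s hs)) hε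
  have hne : ∀ s ∈ Icc c d, V ρ s ≠ 0 := fun s hs => IsLorentzForm.ne_zero_of_neg (hneg s hs).1
  exact ⟨⟨hσ.lt, hsm, fun s hs => ⟨hne s hs, (hneg s hs).1.le⟩,
    fun s hs => (hneg s hs).2⟩, fun s hs => (hneg s hs).1⟩

/-- A causal curve starting at the centre of a normal chart stays in the causal cone. -/
theorem mem_cone_of_causal (hκ : κ ≠ 0) (h : IsNormalChart S.metric e x) {σ : ℝ → M₀ × ℝ}
    {c d : ℝ} (hσ : IsSmoothCausalCurve S.metric (S.orientation κ) σ c d)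
    (hx : σ c = x) (hU : MapsTo σ (Icc c d) e.target) :
    formAt S.metric x (e.symm (σ d)) (e.symm (σ d)) ≤ 0 ∧
      formAt S.metric x (e.symm (σ d)) ((0, κ) : E × ℝ) ≤ 0 := by
  have hd : d ∈ Icc c d := ⟨hσ.lt.le, le_rfl⟩
  -- By compactness, slightly tilted curves remain in the chart. `IccExtend` provides a curve
  -- continuous on all of `ℝ`.
  have hmaps : ∀ᶠ ε in 𝓝 (0 : ℝ), ∀ s ∈ Icc c d,
      ((σ s).1, (σ s).2 + ε * κ * (s - c)) ∈ e.target := by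
    have hc : Continuous (IccExtend hσ.lt.le ((Icc c d).domRestrict σ)) :=
      (continuousOn_iff_continuous_domRestrict.1 hσ.smooth.continuousOn).Icc_extend'
    have hF : Continuous fun z : ℝ × ℝ =>
        ((IccExtend hσ.lt.le ((Icc c d).domRestrict σ) z.2).1,
          (IccExtend hσ.lt.le ((Icc c d).domRestrict σ) z.2).2 + z.1 * κ * (z.2 - c)) := by fun_prop
    have h1 := isCompact_Icc (a := c) (b := d) |>.eventually_forall_of_forall_eventually
      (x₀ := (0 : ℝ)) (P := fun ε s => ((IccExtend hσ.lt.le ((Icc c d).domRestrict σ) s).1,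
          (IccExtend hσ.lt.le ((Icc c d).domRestrict σ) s).2 + ε * κ * (s - c)) ∈ e.target)
      fun s hs => hF.continuousAt.eventually_mem (e.open_target.mem_nhds (by
        simpa [IccExtend_of_mem _ _ hs, domRestrict_apply] using hU hs))
    filter_upwards [h1] with ε hε s hs
    have := hε s hs
    rwa [IccExtend_of_mem _ _ hs, domRestrict_apply] at this
  have hcone : ∀ᶠ ε in 𝓝[>] (0 : ℝ),
      formAt S.metric x (e.symm ((σ d).1, (σ d).2 + ε * κ * (d - c)))
        (e.symm ((σ d).1, (σ d).2 + ε * κ * (d - c))) ≤ 0 ∧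
      formAt S.metric x (e.symm ((σ d).1, (σ d).2 + ε * κ * (d - c))) ((0, κ) : E × ℝ) ≤ 0 := by
    filter_upwards [hmaps.filter_mono nhdsWithin_le_nhds, self_mem_nhdsWithin] with ε hε hε0
    obtain ⟨h1, h2⟩ := tilt_isSmoothCausalCurve hκ hσ hε0
    have := mem_cone_of_timelike hκ h h1 h2 (by simpa using hx) hε
    exact ⟨this.1.le, this.2.le⟩
  have hlim : Filter.Tendsto (fun ε : ℝ => e.symm ((σ d).1, (σ d).2 + ε * κ * (d - c)))
      (𝓝[>] 0) (𝓝 (e.symm (σ d))) := by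
    have h1 : Filter.Tendsto (fun ε : ℝ => ((σ d).1, (σ d).2 + ε * κ * (d - c))) (𝓝 0)
        (𝓝 (σ d)) := by
      have : Continuous fun ε : ℝ => ((σ d).1, (σ d).2 + ε * κ * (d - c)) := by fun_prop
      simpa using this.tendsto 0
    exact ((e.continuousAt_symm (hU hd)).tendsto.comp h1).mono_left nhdsWithin_le_nhds
  have hq : Continuous fun v => formAt S.metric x v v := by fun_prop
  have hl : Continuous fun v => formAt S.metric x v ((0, κ) : E × ℝ) := by fun_prop
  exact ⟨le_of_tendsto ((hq.tendsto _).comp hlim) (hcone.mono fun _ h => h.1),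
    le_of_tendsto ((hl.tendsto _).comp hlim) (hcone.mono fun _ h => h.2)⟩

end ConformallyStandardStationary

/-! ### Local construction of lightlike chains, and globalization. -/

namespace ConformallyStandardStationary

variable {E : Type*} [NormedAddCommGroup E] [NormedSpace ℝ E]
  {M₀ : Type*} [TopologicalSpace M₀] [ChartedSpace E M₀] [IsManifold 𝓘(ℝ, E) ∞ M₀]
  {S : ConformallyStandardStationary E M₀} {κ : ℝ}

/-- On the segment from the timelike `(0, κ)` to a spatial vector `(y, 0)` the quadratic form
vanishes somewhere; the sign is then adjusted. Dimension at least 1 of the spatial factor provides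
`y ≠ 0`. -/
theorem exists_lightlike_vector [Nontrivial E] (hκ : κ ≠ 0) (x : M₀ × ℝ) :
    ∃ n : E × ℝ, formAt S.metric x n n = 0 ∧ formAt S.metric x n ((0, κ) : E × ℝ) < 0 := by
  obtain ⟨y, hy⟩ := exists_ne (0 : E)
  have hB := S.isLorentzForm x hκ
  let n : ℝ → E × ℝ := fun s => (s • y, (1 - s) * κ)
  have hcont : Continuous fun s => formAt S.metric x (n s) (n s) := by fun_prop
  have h0 : formAt S.metric x (n 0) (n 0) ≤ 0 := by simpa [n] using hB.neg.le
  have h1 : 0 ≤ formAt S.metric x (n 1) (n 1) := by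
    rw [formAt_metric]
    simpa [n] using mul_nonneg (S.φ_pos x).le (S.innerAt_nonneg x.1 y)
  obtain ⟨s, -, hs⟩ := intermediate_value_Icc zero_le_one hcont.continuousOn ⟨h0, h1⟩
  have hs' : formAt S.metric x (n s) (n s) = 0 := hs
  have hn : n s ≠ 0 := by
    intro h
    have e1 : s • y = 0 := congrArg Prod.fst h
    have e2 : (1 - s) * κ = 0 := congrArg Prod.snd h
    have e3 := (smul_eq_zero.1 e1).resolve_right hy
    rw [e3] at e2
    simp [hκ] at e2
  rcases lt_or_gt_of_ne (hB.apply_ne_zero hs'.le hn) with h | h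
  · exact ⟨n s, hs', h⟩
  · exact ⟨-n s, by simpa using hs', by simpa using h⟩

variable [FiniteDimensional ℝ E]

/-- If a causal curve from `x` to `y` lies in a convex normal neighbourhood, and `y` is not later
than some point on a lightlike geodesic from `x`, then `y` is reached from `x` by at most two
lightlike geodesics. -/
theorem reflTransGen_of_time_lt (hκ : κ ≠ 0) {U : Set (M₀ × ℝ)} (hU : IsConvexNormal S.metric U)
    {x y : M₀ × ℝ} {e : OpenPartialHomeomorph (E × ℝ) (M₀ × ℝ)} (he : IsNormalChart S.metric e x)
    (heU : e.target = U) {n : E × ℝ} (hne : n ∈ e.source) (hn : formAt S.metric x n n = 0)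
    (hnY : formAt S.metric x n ((0, κ) : E × ℝ) < 0) {σ : ℝ → M₀ × ℝ} {c d : ℝ}
    (hσ : IsSmoothCausalCurve S.metric (S.orientation κ) σ c d) (hc : σ c = x) (hd : σ d = y)
    (hσU : MapsTo σ (Icc c d) U) (hy : κ * y.2 < κ * (e n).2) :
    Relation.ReflTransGen (NullRelated S.metric (S.orientation κ)) x y := by
  have hyU : y ∈ U := hd ▸ hσU ⟨hσ.lt.le, le_rfl⟩
  obtain ⟨a, haU, ha⟩ := (hU.2 y hyU).exists_chart
  have hκ' : -κ ≠ 0 := neg_ne_zero.2 hκ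
  have hB := S.isLorentzForm y hκ'
  have hrev := hσ.comp_affine (Y' := S.orientation (-κ)) (neg_lt_neg hσ.lt) (by norm_num)
    (Icc_eq_vadd_neg_one_smul c d) (S.orientation_neg κ)
  -- The lightlike geodesic from `x`, seen from `y`. Convexity of `U` is what provides a normal
  -- chart at `y` containing it.
  let w : ℝ → E × ℝ := fun r => a.symm (e (r • n))
  have hmem : ∀ r ∈ Icc (0 : ℝ) 1, r • n ∈ e.source := fun r hr => he.smul_mem hne hr
  have htgt : ∀ r ∈ Icc (0 : ℝ) 1, e (r • n) ∈ a.target := fun r hr => by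
    rw [haU, ← heU]; exact e.map_source (hmem r hr)
  have haw : ∀ r ∈ Icc (0 : ℝ) 1, a (w r) = e (r • n) := fun r hr => a.right_inv (htgt r hr)
  have hws : ∀ r ∈ Icc (0 : ℝ) 1, w r ∈ a.source := fun r hr => a.map_target (htgt r hr)
  have hwc : ContinuousOn w (Icc 0 1) :=
    a.symm.continuousOn.comp (he.geodesic n hne).smooth.continuousOn htgt
  let q : E × ℝ → ℝ := fun v => formAt S.metric y v v
  let l : E × ℝ → ℝ := fun v => formAt S.metric y v ((0, -κ) : E × ℝ)
  have hq : Continuous q := by fun_prop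
  have hl : Continuous l := by fun_prop
  have hl0 : ∀ v, q v ≤ 0 → v ≠ 0 → l v ≠ 0 := fun v hv hv0 => hB.apply_ne_zero hv hv0
  -- The cone lemma at `y`, for `σ` run backwards with the opposite orientation.
  have h0 : q (w 0) ≤ 0 ∧ l (w 0) ≤ 0 := by
    have h1 := mem_cone_of_causal hκ' ha hrev (by simp [hd]) (by
      rw [haU]
      intro s hs
      exact hσU ⟨by linarith [hs.2], by linarith [hs.1]⟩)
    have h2 : a.symm (σ (-1 * -c + 0)) = w 0 := by simp [w, hc, he.map_zero]
    rw [h2] at h1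
    exact h1
  -- Otherwise `e n` would be `y` or in its causal past, against `hy` since time is strictly
  -- monotone along causal rays.
  have h1 : ¬ (q (w 1) ≤ 0 ∧ l (w 1) ≤ 0) := by
    rintro ⟨hq1, hl1⟩
    have hm : (1 : ℝ) ∈ Icc (0 : ℝ) 1 := ⟨zero_le_one, le_rfl⟩
    have haw1 : a (w 1) = e n := by rw [haw 1 hm, one_smul]
    by_cases hw0 : w 1 = 0
    · rw [hw0, ha.map_zero] at haw1
      rw [haw1] at hy
      exact lt_irrefl _ hy
    · have hlt := time_lt (ray_isSmoothCausalCurve hκ' ha (hws 1 hm) hq1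
        (lt_of_le_of_ne hl1 (hl0 _ hq1 hw0)))
      rw [zero_smul, one_smul, ha.map_zero, haw1] at hlt
      linarith
  let A : Set ℝ := {r ∈ Icc (0 : ℝ) 1 | q (w r) ≤ 0 ∧ l (w r) ≤ 0}
  have hA0 : (0 : ℝ) ∈ A := ⟨⟨le_rfl, zero_le_one⟩, h0⟩
  have hbdd : BddAbove A := ⟨1, fun r hr => hr.1.2⟩
  have hAcl : IsClosed A := by
    have hcl : IsClosed {v | q v ≤ 0 ∧ l v ≤ 0} :=
      (isClosed_le hq continuous_const).inter (isClosed_le hl continuous_const)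
    exact hwc.preimage_isClosed_of_isClosed isClosed_Icc hcl
  set r := sSup A with hr
  have hrA : r ∈ A := hAcl.csSup_mem ⟨0, hA0⟩ hbdd
  obtain ⟨hrI, hqr, hlr⟩ := hrA
  have hr1 : r < 1 := lt_of_le_of_ne hrI.2 fun h => h1 (h ▸ ⟨hqr, hlr⟩)
  -- If `w r` were timelike, it would be interior to the cone, and slightly larger parameters would
  -- also belong to `A`.
  have hnull : q (w r) = 0 := by
    by_contra hq0
    have hqneg : q (w r) < 0 := lt_of_le_of_ne hqr hq0
    have hlneg : l (w r) < 0 :=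
      lt_of_le_of_ne hlr (hl0 _ hqr (IsLorentzForm.ne_zero_of_neg hqneg))
    have hop : IsOpen {v | q v < 0 ∧ l v < 0} :=
      (isOpen_lt hq continuous_const).inter (isOpen_lt hl continuous_const)
    have hev : ∀ᶠ s in 𝓝[Icc (0 : ℝ) 1] r, q (w s) < 0 ∧ l (w s) < 0 :=
      (hwc r hrI).eventually (hop.mem_nhds ⟨hqneg, hlneg⟩)
    have hev' : ∀ᶠ s in 𝓝[Ioo r 1] r, q (w s) < 0 ∧ l (w s) < 0 :=
      hev.filter_mono (nhdsWithin_mono r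
        (Ioo_subset_Icc_self.trans (Icc_subset_Icc_left hrI.1)))
    have : (𝓝[Ioo r 1] r).NeBot := by
      rw [nhdsWithin_Ioo_eq_nhdsGT hr1]; infer_instance
    obtain ⟨s, hs, hsI⟩ := (hev'.and self_mem_nhdsWithin).exists
    have hsA : s ∈ A := ⟨⟨hrI.1.trans hsI.1.le, hsI.2.le⟩, hs.1.le, hs.2.le⟩
    exact (le_csSup hbdd hsA).not_gt hsI.1
  have hfirst : Relation.ReflTransGen (NullRelated S.metric (S.orientation κ)) x (e (r • n)) := by
    rcases eq_or_lt_of_le hrI.1 with h | h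
    · rw [← h, zero_smul, he.map_zero]
    · refine .single ⟨_, 0, 1, ray_isLightlikeGeodesic hκ he (hmem r hrI) (by simp [hn]) ?_,
        by simp [he.map_zero], by simp⟩
      simpa using mul_neg_of_pos_of_neg h hnY
  have hsecond : Relation.ReflTransGen (NullRelated S.metric (S.orientation κ)) (e (r • n)) y := by
    rw [← haw r hrI]
    by_cases hw0 : w r = 0
    · rw [hw0, ha.map_zero]
    · have hN : NullRelated S.metric (S.orientation (-κ)) y (a (w r)) :=
        ⟨_, 0, 1, ray_isLightlikeGeodesic hκ' ha (hws r hrI) hnull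
          (lt_of_le_of_ne hlr (hl0 _ hqr hw0)), by simp [ha.map_zero], by simp⟩
      refine .single (hN.reverse fun p => ?_)
      have := S.orientation_neg (-κ) p
      rwa [neg_neg] at this
  exact hfirst.trans hsecond

/-- The bound is the value of `κ t` at the end of a short lightlike ray from `x`, chosen before `y`;
continuity of a curve then places nearby points below it. -/
theorem exists_time_bound [Nontrivial E] (hκ : κ ≠ 0) {U : Set (M₀ × ℝ)}
    (hU : IsConvexNormal S.metric U) {x : M₀ × ℝ} (hx : x ∈ U) :
    ∃ b, κ * x.2 < b ∧ ∀ y : M₀ × ℝ, κ * y.2 < b → ∀ (σ : ℝ → M₀ × ℝ) (c d : ℝ),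
      IsSmoothCausalCurve S.metric (S.orientation κ) σ c d → σ c = x → σ d = y →
      MapsTo σ (Icc c d) U →
      Relation.ReflTransGen (NullRelated S.metric (S.orientation κ)) x y := by
  obtain ⟨e, heU, he⟩ := (hU.2 x hx).exists_chart
  obtain ⟨n, hn, hnY⟩ := exists_lightlike_vector (S := S) hκ x
  have hc : ContinuousAt (fun r : ℝ => r • n) 0 := by fun_prop
  have hm : ∀ᶠ r in 𝓝[>] (0 : ℝ), r • n ∈ e.source :=
    (hc.eventually_mem (e.open_source.mem_nhds (by simpa using he.zero_mem))).filter_mono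
      nhdsWithin_le_nhds
  obtain ⟨r, hr, hr0⟩ := (hm.and self_mem_nhdsWithin).exists
  have hn' : formAt S.metric x (r • n) (r • n) = 0 := by simp [hn]
  have hnY' : formAt S.metric x (r • n) ((0, κ) : E × ℝ) < 0 := by
    simpa using mul_neg_of_pos_of_neg hr0 hnY
  refine ⟨κ * (e (r • n)).2, ?_, fun y hy σ c d hσ hσc hσd hσU =>
    reflTransGen_of_time_lt hκ hU he heU hr hn' hnY' hσ hσc hσd hσU hy⟩
  have := time_lt (ray_isSmoothCausalCurve hκ he hr hn'.le hnY')
  simpa [he.map_zero] using this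

/-- Causally related points are joined by lightlike geodesics. -/
theorem transGen_of_isCausalCurve [Nontrivial E] {γ : ℝ → M₀ × ℝ} {a b : ℝ}
    (hγ : IsCausalCurve S.metric S.timeField γ a b) :
    Relation.TransGen (NullRelated S.metric S.timeField) (γ a) (γ b) := by
  have hends := relates_endpoints_of_locally
    (R := fun r s => r = s ∨ Relation.TransGen (NullRelated S.metric S.timeField) (γ r) (γ s))
    (fun _ => .inl rfl) (by
      rintro r s t (rfl | h1) (rfl | h2)
      exacts [.inl rfl, .inr h2, .inr h1, .inr (h1.trans h2)]) hγ.lt.le fun s hs => ?_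
  · exact hends.resolve_left hγ.lt.ne
  obtain ⟨U, hU, hsU, J, hJ, hJsub, -, hJc⟩ := hγ.locally_causal s hs
  have hsJ : s ∈ J := mem_of_mem_nhdsWithin hs hJ
  obtain ⟨b₁, hb₁, h₁⟩ := exists_time_bound (S := S) (κ := 1) one_ne_zero hU hsU
  -- The bound for reversed time serves parameters before `s`: only `γ s` may play the role of the
  -- base point, since the bound depends on it.
  obtain ⟨b₂, hb₂, h₂⟩ := exists_time_bound (S := S) (κ := -1) (by norm_num) hU hsU
  have hcont : ∀ κ : ℝ, ContinuousWithinAt (fun r => κ * (γ r).2) (Icc a b) s := fun κ =>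
    (continuous_snd.continuousAt.comp_continuousWithinAt (hγ.continuousOn s hs)).const_smul κ
  -- The chain is not empty, because time increases strictly along `σ` and its end points differ.
  have hstrict : ∀ {y z : M₀ × ℝ} {σ : ℝ → M₀ × ℝ} {c d : ℝ},
      IsSmoothCausalCurve S.metric S.timeField σ c d → σ c = y → σ d = z →
      Relation.ReflTransGen (NullRelated S.metric S.timeField) y z →
      Relation.TransGen (NullRelated S.metric S.timeField) y z := by
    rintro y z σ c d hσ rfl rfl h
    refine (Relation.reflTransGen_iff_eq_or_transGen.1 h).resolve_left fun heq => ?_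
    have := time_lt (S := S) (κ := 1) hσ
    rw [heq] at this
    exact lt_irrefl _ this
  filter_upwards [hJ, (hcont 1).eventually (gt_mem_nhds hb₁),
    (hcont (-1)).eventually (gt_mem_nhds hb₂)] with r hrJ hr₁ hr₂
  constructor
  · intro hsr
    obtain ⟨σ, c, d, hσ, hσc, hσd, hσU⟩ := hJc s hsJ r hrJ hsr
    exact .inr (hstrict hσ hσc hσd (h₁ (γ r) hr₁ σ c d hσ hσc hσd hσU))
  · intro hrs
    obtain ⟨σ, c, d, hσ, hσc, hσd, hσU⟩ := hJc r hrJ s hsJ hrs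
    have hrev := hσ.comp_affine (Y' := S.orientation (-1)) (neg_lt_neg hσ.lt) (by norm_num)
      (Icc_eq_vadd_neg_one_smul c d) (S.orientation_neg 1)
    have h3 := h₂ (γ r) hr₂ _ _ _ hrev (by simp [hσd]) (by simp [hσc]) fun t ht =>
      hσU ⟨by linarith [ht.2], by linarith [ht.1]⟩
    refine .inr (hstrict hσ hσc hσd (Relation.reflTransGen_swap.1
      (Relation.ReflTransGen.mono (fun p q hpq => ?_) _ _ h3)))
    refine hpq.reverse fun z => ?_
    have := S.orientation_neg (-1) z
    rwa [neg_neg] at this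

end ConformallyStandardStationary

end Spacetime

end

theorem mainTheorem8 {E : Type*} [NormedAddCommGroup E] [NormedSpace ℝ E]
    [FiniteDimensional ℝ E] [Nontrivial E]
    {M₀ : Type*} [TopologicalSpace M₀] [T2Space M₀] [ChartedSpace E M₀]
    [IsManifold 𝓘(ℝ, E) ∞ M₀]
    (S : Spacetime.ConformallyStandardStationary E M₀) (p q : M₀ × ℝ) :
    (q ∈ Spacetime.causalFuture S.metric S.timeField p →
      ∃ (γ : ℝ → M₀ × ℝ) (a b : ℝ),
        Spacetime.IsPiecewiseLightlikeGeodesic S.metric S.timeField γ a b ∧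
          γ a = p ∧ γ b = q) ∧
    (q ∈ Spacetime.causalPast S.metric S.timeField p →
      ∃ (γ : ℝ → M₀ × ℝ) (a b : ℝ),
        Spacetime.IsPiecewiseLightlikeGeodesic S.metric S.timeField γ a b ∧
          γ a = q ∧ γ b = p) := by
  have main : ∀ p q : M₀ × ℝ, (∃ (γ : ℝ → M₀ × ℝ) (a b : ℝ),
      Spacetime.IsCausalCurve S.metric S.timeField γ a b ∧ γ a = p ∧ γ b = q) →
      ∃ (γ : ℝ → M₀ × ℝ) (a b : ℝ),
        Spacetime.IsPiecewiseLightlikeGeodesic S.metric S.timeField γ a b ∧ γ a = p ∧ γ b = q := by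
    rintro _ _ ⟨γ, a, b, hγ, rfl, rfl⟩
    exact Spacetime.exists_piecewise_of_transGen
      (Spacetime.ConformallyStandardStationary.transGen_of_isCausalCurve hγ)
  exact ⟨main p q, main q p⟩
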